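/- Let $G$ be a finite connected $4$-valent graph (loops and multiple edges allowed) with at least one vertex, embedded in the plane and regarded up to orientation-preserving homeomorphism of the plane. Opposite edges at a vertex are thought of as crossing there. A loop configuration in $G$ is a bounded face whose boundary consists of one edge (a loop at a vertex, with nothing inside). A bigon configuration is a bounded face whose boundary consists of exactly two edges joining two distinct vertices (two arcs that cross twice, with nothing in between). A simple triangle is a bounded face whose boundary consists of exactly three edges with three distinct corner vertices (three arcs that cross pairwise, with nothing in between). A triangle move replaces, inside a disc that contains a simple triangle and no other vertices, the picture of the three pairwise crossing arcs by the one obtained by sliding one arc over the crossing of the other two: if the six ends on the boundary of the disc are numbered $1,\dots,6$ in cyclic order and meet in pairs $12,34,56$ at the corners of the old triangle, they meet in pairs $23,45,61$ at the corners of the new one, $i$ and $i+3$ still being the ends of one arc; nothing changes outside the disc. If $G$ contains neither a loop configuration nor a bigon configuration, then a finite sequence of triangle moves turns $G$ into a connected plane $4$-valent graph that contains a bigon configuration. -/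

import Mathlib

/-- A finite 4-valent graph (loops and multiple edges allowed) drawn on a closed oriented surface
with simply connected faces, up to homeomorphism. `D` is the set of darts (an edge with one of its
two directions, regarded as issuing from its initial vertex), `rev` reverses a dart, and `rot`
sends a dart to the next dart, in clockwise order, issuing from the same vertex. Vertices are
the cycles of `rot`, each consisting of four darts; edges are the cycles of `rev`. -/
structure FourValentMap (D : Type*) where
  rot : Equiv.Perm D
  rev : Equiv.Perm D
  rev_rev : ∀ d, rev (rev d) = d
  rev_ne : ∀ d, rev d ≠ d
  rot_four : ∀ d, rot (rot (rot (rot d))) = d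
  rot_two_ne : ∀ d, rot (rot d) ≠ d

namespace FourValentMap

variable {D : Type*} (G : FourValentMap D)

/-- The next dart on the boundary of the face lying to the left of `d`: run along `d` and leave
its final vertex by the leftmost exit. -/
def next : Equiv.Perm D := G.rot * G.rev

/-- The vertices. -/
def Vertex : Type _ := Quotient (Equiv.Perm.SameCycle.setoid G.rot)

/-- The edges. -/
def Edge : Type _ := Quotient (Equiv.Perm.SameCycle.setoid G.rev)

/-- The faces. -/
def Face : Type _ := Quotient (Equiv.Perm.SameCycle.setoid G.next)

/-- The initial vertex of a dart. -/
def vertexOf (d : D) : G.Vertex := Quotient.mk (Equiv.Perm.SameCycle.setoid G.rot) d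

/-- The face to the left of a dart. -/
def faceOf (d : D) : G.Face := Quotient.mk (Equiv.Perm.SameCycle.setoid G.next) d

/-- Any two darts are joined by a sequence of the two operations `rot` and `rev`. -/
def Connected : Prop :=
  MulAction.IsPretransitive (Subgroup.closure ({G.rot, G.rev} : Set (Equiv.Perm D))) D

/-- The surface is a sphere (Euler's formula for a connected graph, `V - E + F = 2`). -/
def Spherical : Prop := Nat.card G.Vertex + Nat.card G.Face = Nat.card G.Edge + 2

end FourValentMap

/-- A connected 4-valent graph, having at least one vertex, embedded in the plane, up to
orientation preserving homeomorphism of the plane: a connected 4-valent graph on the sphere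
with one of its faces chosen as the unbounded one. -/
structure PlaneFourValentGraph (D : Type*) extends FourValentMap D where
  connected : toFourValentMap.Connected
  spherical : toFourValentMap.Spherical
  outer : toFourValentMap.Face

namespace PlaneFourValentGraph

variable {D : Type*} (G : PlaneFourValentGraph D)

/-- The dart `d` bounds a loop configuration: it is a loop with empty inside, that is, it is by
itself the whole boundary of a bounded face. -/
def IsLoop (d : D) : Prop := G.next d = d ∧ G.faceOf d ≠ G.outer

/-- The dart `d` lies on a bigon configuration: the face to its left is bounded, with exactly two
sides, joining two distinct vertices (so two arcs cross twice, with nothing in between). -/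
def IsBigon (d : D) : Prop :=
  G.next (G.next d) = d ∧ G.vertexOf d ≠ G.vertexOf (G.next d) ∧ G.faceOf d ≠ G.outer

/-- The dart `d` lies on a simple triangle: the face to its left is bounded, with exactly three
sides, and its three corners are distinct vertices (so three arcs cross pairwise, with nothing
in between). -/
def IsTriangle (d : D) : Prop :=
  G.next (G.next (G.next d)) = d ∧
  G.vertexOf d ≠ G.vertexOf (G.next d) ∧
  G.vertexOf (G.next d) ≠ G.vertexOf (G.next (G.next d)) ∧
  G.vertexOf (G.next (G.next d)) ≠ G.vertexOf d ∧
  G.faceOf d ≠ G.outer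

/-- `e` or its reverse is one of the three sides of the triangle to the left of `d`. -/
def IsSide (d e : D) : Prop :=
  e = d ∨ e = G.next d ∨ e = G.next (G.next d) ∨
  e = G.rev d ∨ e = G.rev (G.next d) ∨ e = G.rev (G.next (G.next d))

/-- The six darts issuing outwards from the corners of the triangle to the left of `d`, in
counterclockwise order around the triangle. The first two issue from the first corner, the next
two from the second, the last two from the third. -/
def legs (d : D) : List D :=
  let a := d
  let b := G.next d
  let c := G.next (G.next d)
  [G.rot (G.rot a), G.rot a, G.rot (G.rot b), G.rot b, G.rot (G.rot c), G.rot c]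

/-- Cyclic shift by one step of the six legs of the triangle; all other darts are fixed. -/
def shift [DecidableEq D] (d : D) : Equiv.Perm D := (G.legs d).formPerm

/-- `H` arises from `G` by a triangle move at the triangle to the left of `d`: an arc is slid over
the crossing of the two other arcs. Number the legs `1, …, 6` around the triangle. Before the move
they meet in pairs `12`, `34`, `56` at the three corners; afterwards they meet in pairs
`23`, `45`, `61` at the corners of the new triangle. So the edges are kept, and `rot` is conjugated
by the shift of the legs. Outside a disc containing the triangle the faces are unchanged, and the
unbounded face remains the same: a dart that is not a side of the triangle has the unbounded face
to its left after the move if and only if it had so before. -/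
def TriangleMoveAt [DecidableEq D] (G H : PlaneFourValentGraph D) (d : D) : Prop :=
  G.IsTriangle d ∧
  H.rev = G.rev ∧
  H.rot = G.shift d * G.rot * (G.shift d)⁻¹ ∧
  ∀ e, ¬ G.IsSide d e → (H.faceOf e = H.outer ↔ G.faceOf e = G.outer)

/-- `H` arises from `G` by one triangle move. -/
def TriangleMove [DecidableEq D] (G H : PlaneFourValentGraph D) : Prop :=
  ∃ d, G.TriangleMoveAt H d

end PlaneFourValentGraph

/-!
On the sphere every cycle modulo 2 is the boundary of a set of faces. Hence a loop of a strand
bounds a region without reflex corners and with at most one corner, and filling in the holes gives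
a disc, away from the unbounded face, with at most two corners. Take such a disc with the fewest
darts, a minimal lens. Every strand inside it runs from boundary to boundary without crossing
itself, since otherwise it would bound a smaller lens. Among the discs with three corners that such
a chord cuts off from the lens along its boundary, a smallest one is a triangular face with a side
on the boundary of the lens, as long as there are neither loops nor bigons. The triangle move at
this face pushes its third corner out of the lens. What remains of the lens is again a convex region
with at most two corners, and it is smaller. A move creates no loop unless there was a loop or a
bigon before, so by induction on the size of a minimal lens a bigon must appear.
-/

theorem sameCycle_iff_exists_pow_of_pow_eq_one {α : Type*} {g : Equiv.Perm α} {n : ℕ} (hn : 0 < n)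
    (hg : g ^ n = 1) (x y : α) : g.SameCycle x y ↔ ∃ k : Fin n, y = (g ^ (k : ℕ)) x := by
  constructor
  · rintro ⟨i, rfl⟩
    have hi := Int.emod_nonneg i (Int.natCast_ne_zero.2 hn.ne')
    have hi' := Int.emod_lt_of_pos i (Int.natCast_pos.2 hn)
    refine ⟨⟨(i % n).toNat, by omega⟩, ?_⟩
    rw [← zpow_natCast, Int.toNat_of_nonneg hi, ← zpow_eq_zpow_emod' i hg]
  · rintro ⟨k, rfl⟩
    exact ⟨k, by rw [zpow_natCast]⟩

open scoped Pointwise in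
theorem isPretransitive_closure_iff {Γ α : Type*} [Group Γ] [MulAction Γ α] [Finite α]
    (S : Set Γ) : MulAction.IsPretransitive (Subgroup.closure S) α ↔
      ∀ A : Set α, (∀ g ∈ S, Set.MapsTo (g • ·) A A) → A.Nonempty → A = Set.univ := by
  constructor
  · rintro h A hA ⟨x, hx⟩
    have hstab : Subgroup.closure S ≤ MulAction.stabilizer Γ A := by
      rw [Subgroup.closure_le]
      intro g hg
      rw [SetLike.mem_coe, MulAction.mem_stabilizer_set_iff_smul_set_subset A.toFinite]
      exact Set.image_subset_iff.2 (hA g hg)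
    refine Set.eq_univ_of_forall fun y => ?_
    obtain ⟨⟨g, hg⟩, rfl⟩ := h.exists_smul_eq x y
    rw [← MulAction.mem_stabilizer_iff.1 (hstab hg)]
    exact Set.smul_mem_smul_set hx
  · refine fun h => ⟨fun x y => ?_⟩
    have horbit := h (MulAction.orbit (Subgroup.closure S) x)
      (fun g hg _ hz => MulAction.mem_orbit_of_mem_orbit
        (⟨g, Subgroup.subset_closure hg⟩ : Subgroup.closure S) hz) ⟨x, MulAction.mem_orbit_self x⟩
    exact Set.eq_univ_iff_forall.1 horbit y

theorem eq_or_eq_add_one_of_fin_three (i j : Fin 3) : j = i ∨ j = i + 1 ∨ j = i + 1 + 1 := by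
  decide +revert

namespace FourValentMap

variable {D : Type*}

section Darts

variable (G : FourValentMap D)

theorem next_apply (d : D) : G.next d = G.rot (G.rev d) := rfl

theorem next_rev (d : D) : G.next (G.rev d) = G.rot d := by
  rw [next_apply, G.rev_rev]

theorem rot_ne (d : D) : G.rot d ≠ d := fun h => G.rot_two_ne d (by rw [h, h])

theorem rot_three_ne (d : D) : G.rot (G.rot (G.rot d)) ≠ d := fun h =>
  G.rot_ne d (by have := G.rot_four d; rwa [h] at this)

/-- The edge of a dart. -/
def edgeOf (d : D) : G.Edge := Quotient.mk (Equiv.Perm.SameCycle.setoid G.rev) d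

theorem vertexOf_surjective : Function.Surjective G.vertexOf := Quotient.exists_rep
theorem edgeOf_surjective : Function.Surjective G.edgeOf := Quotient.exists_rep
theorem faceOf_surjective : Function.Surjective G.faceOf := Quotient.exists_rep

instance [Finite D] : Finite G.Vertex := Finite.of_surjective _ G.vertexOf_surjective
instance [Finite D] : Finite G.Edge := Finite.of_surjective _ G.edgeOf_surjective
instance [Finite D] : Finite G.Face := Finite.of_surjective _ G.faceOf_surjective

theorem vertexOf_eq_iff (d e : D) : G.vertexOf d = G.vertexOf e ↔
    e = d ∨ e = G.rot d ∨ e = G.rot (G.rot d) ∨ e = G.rot (G.rot (G.rot d)) := by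
  have hrot : G.rot ^ 4 = 1 := Equiv.ext fun d => G.rot_four d
  refine Quotient.eq.trans ((sameCycle_iff_exists_pow_of_pow_eq_one four_pos hrot d e).trans ?_)
  constructor
  · rintro ⟨k, rfl⟩
    fin_cases k <;> simp [pow_succ]
  · rintro (rfl | rfl | rfl | rfl)
    exacts [⟨0, rfl⟩, ⟨1, rfl⟩, ⟨2, rfl⟩, ⟨3, rfl⟩]

theorem edgeOf_eq_iff (d e : D) : G.edgeOf d = G.edgeOf e ↔ e = d ∨ e = G.rev d := by
  have hrev : G.rev ^ 2 = 1 := Equiv.ext fun d => G.rev_rev d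
  refine Quotient.eq.trans ((sameCycle_iff_exists_pow_of_pow_eq_one two_pos hrev d e).trans ?_)
  simp [Fin.exists_fin_two]

theorem faceOf_eq_iff (d e : D) : G.faceOf d = G.faceOf e ↔ G.next.SameCycle d e :=
  Quotient.eq (r := Equiv.Perm.SameCycle.setoid G.next)

theorem vertexOf_rot (d : D) : G.vertexOf (G.rot d) = G.vertexOf d :=
  ((G.vertexOf_eq_iff d (G.rot d)).2 (by simp)).symm

theorem edgeOf_rev (d : D) : G.edgeOf (G.rev d) = G.edgeOf d :=
  ((G.edgeOf_eq_iff d _).2 (Or.inr rfl)).symm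

theorem faceOf_next (d : D) : G.faceOf (G.next d) = G.faceOf d :=
  (G.faceOf_eq_iff _ _).2 ⟨-1, by simp⟩

theorem faceOf_rev (d : D) : G.faceOf (G.rev d) = G.faceOf (G.rot d) := by
  rw [← next_rev, faceOf_next]

end Darts

section Connected

variable {G : FourValentMap D} [Finite D] {A : Set D}

theorem connected_iff : G.Connected ↔ ∀ A : Set D, Set.MapsTo G.rot A A → Set.MapsTo G.rev A A →
    A.Nonempty → A = Set.univ :=
  (isPretransitive_closure_iff _).trans
    ⟨fun h A hrot hrev => h A (by rintro _ (rfl | rfl); exacts [hrot, hrev]),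
      fun h A hA => h A (hA _ (Or.inl rfl)) (hA _ (Or.inr rfl))⟩

theorem Connected.eq_univ_of_mapsTo_next (hc : G.Connected) (hnext : Set.MapsTo G.next A A)
    (hrev : Set.MapsTo G.rev A A) (hA : A.Nonempty) : A = Set.univ :=
  connected_iff.1 hc A (fun d hd => G.next_rev d ▸ hnext (hrev hd)) hrev hA

end Connected

/-! ### Homology modulo 2 -/

section Incidence

open Classical in
/-- The incidence matrix of two labellings of the same finite set: the entry at `(e, v)` counts the
elements labelled `e` by `q` and `v` by `p`. For the labellings of the darts by edges and by
vertices (or faces) it is the usual incidence matrix. -/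
noncomputable def incidence {κ ι : Type*} (R : Type*) [Semiring R] [Fintype D] (q : D → κ)
    (p : D → ι) : Matrix κ ι R :=
  fun e v => ∑ d with q d = e, if p d = v then 1 else 0

variable [Fintype D]

theorem incidence_transpose {κ ι R : Type*} [Semiring R] (q : D → κ) (p : D → ι) :
    (incidence R q p).transpose = incidence R p q := by
  classical
  ext v e
  simp only [incidence, Matrix.transpose_apply, Finset.sum_filter, ← ite_and]
  exact Finset.sum_congr rfl fun x _ => if_congr and_comm rfl rfl

open Classical in
theorem incidence_mulVec {κ ι R : Type*} [Semiring R] [Fintype ι] (q : D → κ) (p : D → ι)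
    (ψ : ι → R) (e : κ) : (incidence R q p).mulVec ψ e = ∑ d with q d = e, ψ (p d) := by
  simp only [Matrix.mulVec, dotProduct, incidence, Finset.sum_mul, ite_mul, one_mul, zero_mul]
  rw [Finset.sum_comm]
  simp only [Finset.sum_ite_eq, Finset.mem_univ, if_true]

variable (G : FourValentMap D)

open Classical in
theorem sum_edgeOf_fiber {M : Type*} [AddCommMonoid M] (f : D → M) (d : D) :
    ∑ x with G.edgeOf x = G.edgeOf d, f x = f d + f (G.rev d) := by
  have hfiber : (Finset.univ.filter fun x => G.edgeOf x = G.edgeOf d) = {d, G.rev d} := by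
    ext x
    rw [Finset.mem_filter_univ, eq_comm, edgeOf_eq_iff]
    simp
  rw [hfiber, Finset.sum_pair (G.rev_ne d).symm]

open Classical in
theorem sum_vertexOf_fiber {M : Type*} [AddCommMonoid M] (f : D → M) (d : D) :
    ∑ x with G.vertexOf x = G.vertexOf d, f x =
      f d + f (G.rot d) + f (G.rot (G.rot d)) + f (G.rot (G.rot (G.rot d))) := by
  have hfiber : (Finset.univ.filter fun x => G.vertexOf x = G.vertexOf d) =
      {d, G.rot d, G.rot (G.rot d), G.rot (G.rot (G.rot d))} := by
    ext x
    rw [Finset.mem_filter_univ, eq_comm, vertexOf_eq_iff]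
    simp
  have h1 := fun x => (G.rot_ne x).symm
  have h2 := fun x => (G.rot_two_ne x).symm
  have h3 := fun x => (G.rot_three_ne x).symm
  rw [hfiber, Finset.sum_insert (by simp [h1, h2, h3]), Finset.sum_insert (by simp [h1, h2]),
    Finset.sum_pair (h1 _), add_assoc, add_assoc]

theorem incidence_edgeOf_mulVec {ι R : Type*} [Semiring R] [Fintype ι] (p : D → ι)
    (ψ : ι → R) (d : D) :
    (incidence R G.edgeOf p).mulVec ψ (G.edgeOf d) = ψ (p d) + ψ (p (G.rev d)) := by
  classical
  rw [incidence_mulVec, sum_edgeOf_fiber]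

variable {ι : Type*} [Fintype ι] {p : D → ι} {g : Equiv.Perm D}

theorem ker_incidence_edgeOf_le (hp : p.Surjective) (hpg : ∀ d, p (g d) = p d)
    (hconn : ∀ A : Set D, Set.MapsTo g A A → Set.MapsTo G.rev A A → A.Nonempty → A = Set.univ) :
    LinearMap.ker (incidence (ZMod 2) G.edgeOf p).mulVecLin ≤
      Submodule.span (ZMod 2) {fun _ => 1} := by
  intro ψ hψ
  rw [LinearMap.mem_ker, Matrix.mulVecLin_apply] at hψ
  have hψrev : ∀ d, ψ (p (G.rev d)) = ψ (p d) := fun d => by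
    have hsum := G.incidence_edgeOf_mulVec p ψ d
    rw [hψ, Pi.zero_apply] at hsum
    exact (CharTwo.add_eq_zero.1 hsum.symm).symm
  rw [Submodule.mem_span_singleton]
  rcases isEmpty_or_nonempty D with hD | ⟨⟨d₀⟩⟩
  · exact ⟨0, funext fun v => isEmptyElim (hp v).choose⟩
  · refine ⟨ψ (p d₀), funext fun v => ?_⟩
    obtain ⟨d, rfl⟩ := hp v
    have hconst := hconn {d | ψ (p d) = ψ (p d₀)} (fun d hd => by simpa [hpg] using hd)
      (fun d hd => (hψrev d).trans hd) ⟨d₀, rfl⟩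
    simpa using (Set.eq_univ_iff_forall.1 hconst d).symm

theorem card_le_rank_incidence_edgeOf (hp : p.Surjective)
    (hpg : ∀ d, p (g d) = p d)
    (hconn : ∀ A : Set D, Set.MapsTo g A A → Set.MapsTo G.rev A A → A.Nonempty → A = Set.univ) :
    Fintype.card ι ≤ (incidence (ZMod 2) G.edgeOf p).rank + 1 := by
  have := Fintype.ofFinite G.Edge
  have hranknull := (incidence (ZMod 2) G.edgeOf p).mulVecLin.finrank_range_add_finrank_ker
  have hker := (Submodule.finrank_mono (G.ker_incidence_edgeOf_le hp hpg hconn)).trans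
    (finrank_span_le_card _)
  rw [Module.finrank_fintype_fun_eq_card] at hranknull
  simp only [Set.toFinset_singleton, Finset.card_singleton] at hker
  rw [Matrix.rank]
  omega

end Incidence

section Boundary

variable (G : FourValentMap D)

/-- The boundary modulo `2` of a chain of edges, as a function of the darts at a vertex. A chain is
a function of darts that is invariant under `rev`. -/
def boundary (z : D → ZMod 2) (d : D) : ZMod 2 :=
  z d + z (G.rot d) + z (G.rot (G.rot d)) + z (G.rot (G.rot (G.rot d)))

theorem boundary_add (z w : D → ZMod 2) (d : D) :
    G.boundary (fun e => z e + w e) d = G.boundary z d + G.boundary w d := by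
  simp only [boundary]; ring

theorem incidence_vertexOf_mulVec_edgeOf [Fintype D] [Fintype G.Edge] (y : G.Edge → ZMod 2)
    (d : D) : (incidence (ZMod 2) G.vertexOf G.edgeOf).mulVec y (G.vertexOf d) =
      G.boundary (y ∘ G.edgeOf) d := by
  classical
  rw [incidence_mulVec, sum_vertexOf_fiber]
  rfl

theorem boundary_faceBoundary (φ : G.Face → ZMod 2) (d : D) :
    G.boundary (fun e => φ (G.faceOf e) + φ (G.faceOf (G.rev e))) d = 0 := by
  simp only [boundary, faceOf_rev, G.rot_four]
  linear_combination (φ (G.faceOf d) + φ (G.faceOf (G.rot d)) + φ (G.faceOf (G.rot (G.rot d))) +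
    φ (G.faceOf (G.rot (G.rot (G.rot d))))) * (CharTwo.two_eq_zero (R := ZMod 2))

variable {G}

/-- The inclusion of boundaries into cycles is an equality because Euler's formula makes the
dimensions agree. -/
theorem range_incidence_faceOf_eq_ker [Fintype D] [Fintype G.Face] [Fintype G.Edge]
    (hc : G.Connected) (hs : G.Spherical) :
    LinearMap.range (incidence (ZMod 2) G.edgeOf G.faceOf).mulVecLin =
      LinearMap.ker (incidence (ZMod 2) G.vertexOf G.edgeOf).mulVecLin := by
  have := Fintype.ofFinite G.Vertex
  refine Submodule.eq_of_le_of_finrank_le ?_ ?_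
  · rintro _ ⟨φ, rfl⟩
    refine LinearMap.mem_ker.2 (funext fun v => ?_)
    obtain ⟨d, rfl⟩ := G.vertexOf_surjective v
    rw [Matrix.mulVecLin_apply, incidence_vertexOf_mulVec_edgeOf, Pi.zero_apply,
      ← G.boundary_faceBoundary φ d]
    exact congrArg (G.boundary · d) (funext fun e => G.incidence_edgeOf_mulVec G.faceOf φ e)
  · have hvertex := G.card_le_rank_incidence_edgeOf G.vertexOf_surjective G.vertexOf_rot
      (connected_iff.1 hc)
    have hface := G.card_le_rank_incidence_edgeOf G.faceOf_surjective G.faceOf_next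
      fun _ => hc.eq_univ_of_mapsTo_next
    have hranknull :=
      (incidence (ZMod 2) G.vertexOf G.edgeOf).mulVecLin.finrank_range_add_finrank_ker
    rw [← Matrix.rank_transpose, incidence_transpose] at hvertex
    rw [Module.finrank_fintype_fun_eq_card] at hranknull
    unfold Matrix.rank at hvertex hface
    unfold Spherical at hs
    simp only [Nat.card_eq_fintype_card] at hs
    omega

theorem Connected.exists_faceBoundary_eq [Finite D] (hc : G.Connected) (hs : G.Spherical)
    {z : D → ZMod 2} (hrev : ∀ d, z (G.rev d) = z d) (hcycle : ∀ d, G.boundary z d = 0) :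
    ∃ φ : G.Face → ZMod 2, ∀ d, z d = φ (G.faceOf d) + φ (G.faceOf (G.rev d)) := by
  have := Fintype.ofFinite D
  have := Fintype.ofFinite G.Edge
  have := Fintype.ofFinite G.Face
  obtain ⟨y, rfl⟩ : ∃ y : G.Edge → ZMod 2, z = y ∘ G.edgeOf := by
    refine (Function.factorsThrough_iff z).1 fun d e hde => ?_
    rcases (G.edgeOf_eq_iff d e).1 hde with rfl | rfl
    · rfl
    · exact (hrev d).symm
  have hy : y ∈ LinearMap.ker (incidence (ZMod 2) G.vertexOf G.edgeOf).mulVecLin := by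
    refine LinearMap.mem_ker.2 (funext fun v => ?_)
    obtain ⟨d, rfl⟩ := G.vertexOf_surjective v
    rw [Matrix.mulVecLin_apply, incidence_vertexOf_mulVec_edgeOf, hcycle, Pi.zero_apply]
  rw [← range_incidence_faceOf_eq_ker hc hs] at hy
  obtain ⟨φ, rfl⟩ := hy
  exact ⟨φ, fun d => G.incidence_edgeOf_mulVec G.faceOf φ d⟩

end Boundary

section Strands

variable (G : FourValentMap D)

/-- The dart following `d` on its strand: the one opposite to `rev d`. -/
def straight : Equiv.Perm D := G.rot * G.rot * G.rev

theorem straight_apply (d : D) : G.straight d = G.rot (G.rot (G.rev d)) := rfl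

theorem rot_rot_straight (d : D) : G.rot (G.rot (G.straight d)) = G.rev d := by
  rw [straight_apply, G.rot_four]

theorem straight_rev_straight (d : D) : G.straight (G.rev (G.straight d)) = G.rev d := by
  rw [straight_apply, G.rev_rev, rot_rot_straight]

theorem straight_pow_succ (n : ℕ) (d : D) :
    (G.straight ^ (n + 1)) d = G.straight ((G.straight ^ n) d) := by
  rw [pow_succ', Equiv.Perm.mul_apply]

theorem straight_pow_add (m n : ℕ) (d : D) :
    (G.straight ^ (m + n)) d = (G.straight ^ n) ((G.straight ^ m) d) := by
  rw [add_comm, pow_add, Equiv.Perm.mul_apply]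

theorem rev_straight_pow (n : ℕ) (d : D) :
    G.rev ((G.straight ^ n) d) = G.rot (G.rot ((G.straight ^ (n + 1)) d)) := by
  rw [straight_pow_succ, rot_rot_straight]

theorem straight_pow_straight (n : ℕ) (d : D) :
    (G.straight ^ n) (G.straight d) = (G.straight ^ (n + 1)) d := by
  rw [pow_succ, Equiv.Perm.mul_apply]

theorem straight_pow_rev (n : ℕ) (d : D) :
    (G.straight ^ n) (G.rev ((G.straight ^ n) d)) = G.rev d := by
  induction n with
  | zero => simp
  | succ n ih =>
    rw [← straight_pow_straight, straight_pow_succ, straight_rev_straight, ih]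

/-- A first coincidence of the two directions would be in the middle, on a single edge or at a
single vertex. -/
theorem straight_pow_ne_rev (n : ℕ) (d : D) : (G.straight ^ n) d ≠ G.rev d := by
  intro h
  obtain ⟨m, rfl | rfl⟩ := n.even_or_odd'
  · rw [two_mul, straight_pow_add, ← G.straight_pow_rev m] at h
    exact G.rev_ne _ ((G.straight ^ m).injective h).symm
  · rw [two_mul, add_right_comm, straight_pow_add, straight_pow_succ, ← G.straight_pow_rev m] at h
    exact G.rot_two_ne _ ((G.straight ^ m).injective h)

theorem straight_pow_ne_rev_pow (m n : ℕ) (d : D) :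
    (G.straight ^ m) d ≠ G.rev ((G.straight ^ n) d) := by
  intro h
  apply G.straight_pow_ne_rev (m + n) d
  rw [straight_pow_add, h, straight_pow_rev]

theorem vertexOf_straight (d : D) : G.vertexOf (G.straight d) = G.vertexOf (G.rev d) := by
  rw [straight_apply, vertexOf_rot, vertexOf_rot]

theorem sameCycle_straight_rev (d e : D) :
    G.straight.SameCycle (G.rev d) (G.rev e) ↔ G.straight.SameCycle d e := by
  have hconj : G.rev * G.straight * G.rev⁻¹ = G.straight⁻¹ := by
    refine eq_inv_of_mul_eq_one_left (Equiv.ext fun x => ?_)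
    have hrev : G.rev⁻¹ = G.rev := inv_eq_of_mul_eq_one_left (Equiv.ext G.rev_rev)
    simp only [hrev, Equiv.Perm.mul_apply, straight_rev_straight, G.rev_rev, Equiv.Perm.one_apply]
  rw [← Equiv.Perm.sameCycle_inv, ← hconj, Equiv.Perm.sameCycle_conj, Equiv.Perm.coe_inv,
    Equiv.symm_apply_apply, Equiv.symm_apply_apply]

/-- The strand through `d`: the closed curve that goes straight on at every vertex, as the set of
its darts in both directions. -/
def strand (d : D) : Set D := {e | G.straight.SameCycle d e ∨ G.straight.SameCycle d (G.rev e)}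

theorem self_mem_strand (d : D) : d ∈ G.strand d := Or.inl (.refl _ _)

variable {G}

theorem rev_mem_strand {d e : D} : G.rev e ∈ G.strand d ↔ e ∈ G.strand d := by
  simp only [strand, Set.mem_ofPred_eq, G.rev_rev, or_comm]

theorem strand_eq_of_sameCycle {d e : D} (h : G.straight.SameCycle d e) :
    G.strand e = G.strand d := by
  ext x
  exact or_congr ⟨h.trans, h.symm.trans⟩ ⟨h.trans, h.symm.trans⟩

theorem strand_rev (d : D) : G.strand (G.rev d) = G.strand d := by
  ext x
  rw [← rev_mem_strand]
  simp only [strand, Set.mem_ofPred_eq, sameCycle_straight_rev]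

theorem strand_eq_of_mem {d e : D} (h : e ∈ G.strand d) : G.strand e = G.strand d := by
  obtain h | h := h
  · exact strand_eq_of_sameCycle h
  · rw [← strand_rev, strand_eq_of_sameCycle h]

variable (G) in
/-- The first `n` edges of the strand that starts with `d`, as the set of their darts in both
directions. -/
def arc (d : D) (n : ℕ) : Set D :=
  {e | ∃ m < n, e = (G.straight ^ m) d ∨ e = G.rev ((G.straight ^ m) d)}

theorem arc_subset_strand (d : D) (n : ℕ) : G.arc d n ⊆ G.strand d := by
  rintro _ ⟨m, -, rfl | rfl⟩
  · exact Or.inl ⟨m, by rw [zpow_natCast]⟩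
  · exact Or.inr ⟨m, by rw [zpow_natCast, G.rev_rev]⟩

theorem exists_vertex_of_mem_arc {d e : D} {n : ℕ} (he : e ∈ G.arc d n) :
    ∃ m ≤ n, (m < n ∧ e = (G.straight ^ m) d) ∨
      (0 < m ∧ e = G.rot (G.rot ((G.straight ^ m) d))) := by
  obtain ⟨m, hm, rfl | rfl⟩ := he
  · exact ⟨m, hm.le, Or.inl ⟨hm, rfl⟩⟩
  · exact ⟨m + 1, hm, Or.inr ⟨m.succ_pos, G.rev_straight_pow m d⟩⟩

end Strands

section Regions

variable (G : FourValentMap D)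

/-- A union of faces, given by the darts with these faces to their left. A dart `d` also stands for
the corner between `d` and the preceding dart at its initial vertex, and the corner on the
other side of `d` is `rot d`. -/
def IsRegion (X : Set D) : Prop := ∀ d, G.next d ∈ X ↔ d ∈ X

/-- The darts, in both directions, of the edges between `X` and its complement. -/
def border (X : Set D) : Set D := {d | ¬ (d ∈ X ↔ G.rev d ∈ X)}

/-- At each vertex the corners belonging to the region are none, one, two adjacent ones or all. -/
def IsConvex (X : Set D) : Prop := ∀ d ∈ X, G.rot (G.rot d) ∈ X → G.rot d ∈ X

/-- The convex corners of a region. -/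
def corners (X : Set D) : Set D := {d | d ∈ X ∧ G.rot d ∉ X ∧ G.rot (G.rot (G.rot d)) ∉ X}

variable {G}

theorem mem_border_of_mem {X : Set D} {d : D} (hd : d ∈ X) (hd' : G.rev d ∉ X) : d ∈ G.border X :=
  fun h => hd' (h.1 hd)

theorem notMem_border {X : Set D} {d : D} (hd : d ∉ X) (hd' : G.rev d ∉ X) : d ∉ G.border X :=
  not_not.2 (iff_of_false hd hd')

theorem rev_mem_iff_of_notMem_border {X : Set D} {d : D} (hd : d ∉ G.border X) :
    G.rev d ∈ X ↔ d ∈ X :=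
  (not_not.1 hd).symm

theorem rev_mem_border {X : Set D} {d : D} : G.rev d ∈ G.border X ↔ d ∈ G.border X := by
  rw [border, Set.mem_ofPred_eq, Set.mem_ofPred_eq, G.rev_rev]
  exact not_congr iff_comm

theorem border_compl (X : Set D) : G.border Xᶜ = G.border X := by
  ext d
  exact not_congr not_iff_not

theorem border_subset_iff {X P : Set D} (hP : ∀ d, G.rev d ∈ P ↔ d ∈ P) :
    G.border X ⊆ P ↔ ∀ d ∈ X, G.rev d ∉ X → d ∈ P := by
  refine ⟨fun h d hd hd' => h (mem_border_of_mem hd hd'), fun h d hd => ?_⟩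
  by_cases hdX : d ∈ X
  · exact h d hdX fun hd' => hd ⟨fun _ => hd', fun _ => hdX⟩
  · rw [← hP]
    have hd' : G.rev d ∈ X := by_contra fun hd' => hd (iff_of_false hdX hd')
    exact h _ hd' (by rwa [G.rev_rev])

namespace IsRegion

variable {X Y : Set D}

theorem rev_mem (hX : G.IsRegion X) (d : D) : G.rev d ∈ X ↔ G.rot d ∈ X := by
  rw [← hX (G.rev d), next_rev]

theorem mem_border (hX : G.IsRegion X) {d : D} : d ∈ G.border X ↔ ¬ (d ∈ X ↔ G.rot d ∈ X) := by
  rw [← hX.rev_mem]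
  rfl

theorem compl (hX : G.IsRegion X) : G.IsRegion Xᶜ := fun d => not_congr (hX d)

theorem inter (hX : G.IsRegion X) (hY : G.IsRegion Y) : G.IsRegion (X ∩ Y) :=
  fun d => and_congr (hX d) (hY d)

theorem union (hX : G.IsRegion X) (hY : G.IsRegion Y) : G.IsRegion (X ∪ Y) :=
  fun d => or_congr (hX d) (hY d)

theorem rot_three_straight_mem (hX : G.IsRegion X) (d : D) :
    G.rot (G.rot (G.rot (G.straight d))) ∈ X ↔ d ∈ X := by
  rw [rot_rot_straight, ← next_apply, hX]

end IsRegion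

variable (G) in
/-- The union of the faces that can be reached from the left of `o` without crossing an edge in
`P`. -/
def component (P : Set D) (o : D) : Set D :=
  {e | ∀ X, G.IsRegion X → o ∈ X → G.border X ⊆ P → e ∈ X}

theorem self_mem_component (P : Set D) (o : D) : o ∈ G.component P o := fun _ _ ho _ => ho

theorem isRegion_component (P : Set D) (o : D) : G.IsRegion (G.component P o) := fun e =>
  ⟨fun h X hX ho hP => (hX e).1 (h X hX ho hP), fun h X hX ho hP => (hX e).2 (h X hX ho hP)⟩

theorem component_subset {P X : Set D} {o : D} (hX : G.IsRegion X) (ho : o ∈ X)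
    (hP : G.border X ⊆ P) : G.component P o ⊆ X := fun _ he => he X hX ho hP

theorem rev_mem_component_iff {P : Set D} {o e : D} (he : e ∉ P) :
    G.rev e ∈ G.component P o ↔ e ∈ G.component P o :=
  forall₄_congr fun _ _ _ hP => rev_mem_iff_of_notMem_border fun h => he (hP h)

end Regions

/-! ### Regions bounded by loops of a strand -/

section Chains

variable (G : FourValentMap D)

open Classical in
/-- The chain modulo `2` consisting of one edge. -/
noncomputable def edgeChain (d e : D) : ZMod 2 := if G.edgeOf d = G.edgeOf e then 1 else 0

open Classical in
/-- The chain modulo `2` consisting of one vertex, as a function of the darts at vertices. -/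
noncomputable def vertexChain (d e : D) : ZMod 2 := if G.vertexOf d = G.vertexOf e then 1 else 0

/-- The chain of the first `n` edges of the strand that starts with `d`. -/
noncomputable def arcChain (d : D) (n : ℕ) (e : D) : ZMod 2 :=
  ∑ m ∈ Finset.range n, G.edgeChain ((G.straight ^ m) d) e

theorem edgeChain_rev (d e : D) : G.edgeChain d (G.rev e) = G.edgeChain d e := by
  classical exact if_congr (by rw [edgeOf_rev]) rfl rfl

theorem arcChain_rev (d : D) (n : ℕ) (e : D) :
    G.arcChain d n (G.rev e) = G.arcChain d n e := by
  simp only [arcChain, edgeChain_rev]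

theorem boundary_edgeChain [Finite D] (d e : D) :
    G.boundary (G.edgeChain d) e = G.vertexChain d e + G.vertexChain (G.rev d) e := by
  classical
  have := Fintype.ofFinite D
  calc G.boundary (G.edgeChain d) e
      = ∑ x with G.vertexOf x = G.vertexOf e, G.edgeChain d x := (G.sum_vertexOf_fiber _ e).symm
    _ = ∑ x with G.edgeOf x = G.edgeOf d, G.vertexChain x e := by
        simp only [edgeChain, vertexChain, Finset.sum_filter, ← ite_and]
        exact Finset.sum_congr rfl fun x _ =>
          if_congr (by rw [and_comm, eq_comm (a := G.edgeOf d)]) rfl rfl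
    _ = _ := G.sum_edgeOf_fiber _ d

theorem boundary_arcChain [Finite D] (d : D) (n : ℕ) (e : D) :
    G.boundary (G.arcChain d n) e =
      G.vertexChain d e + G.vertexChain ((G.straight ^ n) d) e := by
  induction n with
  | zero => simp [arcChain, boundary, CharTwo.add_self_eq_zero]
  | succ n ih =>
    have hsucc : G.arcChain d (n + 1) =
        fun x => G.arcChain d n x + G.edgeChain ((G.straight ^ n) d) x :=
      funext fun x => Finset.sum_range_succ _ _
    have hend : G.vertexChain (G.rev ((G.straight ^ n) d)) e =
        G.vertexChain ((G.straight ^ (n + 1)) d) e := by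
      rw [vertexChain, vertexChain, straight_pow_succ, vertexOf_straight]
    rw [hsucc, boundary_add, ih, boundary_edgeChain, hend, add_assoc,
      CharTwo.add_cancel_left]

theorem arcChain_eq_one_iff {d : D} {n : ℕ}
    (hinj : ∀ m < n, ∀ m' < n, (G.straight ^ m) d = (G.straight ^ m') d → m = m') (e : D) :
    G.arcChain d n e = 1 ↔ e ∈ G.arc d n := by
  classical
  by_cases he : e ∈ G.arc d n
  · refine iff_of_true ?_ he
    obtain ⟨m, hm, he⟩ := he
    rw [arcChain, Finset.sum_eq_single_of_mem m (Finset.mem_range.2 hm)]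
    · exact if_pos ((G.edgeOf_eq_iff _ e).2 he)
    · intro m' hm' hne
      refine if_neg fun he' => hne ?_
      rw [← (G.edgeOf_eq_iff _ e).2 he, edgeOf_eq_iff] at he'
      obtain he' | he' := he'
      · exact (hinj m hm m' (Finset.mem_range.1 hm') he').symm
      · exact absurd he' (G.straight_pow_ne_rev_pow _ _ _)
  · refine iff_of_false ?_ he
    rw [arcChain, Finset.sum_eq_zero]
    · exact zero_ne_one
    · exact fun m hm => if_neg fun hme =>
        he ⟨m, Finset.mem_range.1 hm, (G.edgeOf_eq_iff _ e).1 hme⟩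

variable {G}

theorem Connected.exists_isRegion_border_eq [Finite D] (hc : G.Connected) (hs : G.Spherical)
    {z : D → ZMod 2} (hrev : ∀ d, z (G.rev d) = z d) (hcycle : ∀ d, G.boundary z d = 0) (o : D) :
    ∃ X : Set D, G.IsRegion X ∧ o ∉ X ∧ ∀ d, d ∈ G.border X ↔ z d = 1 := by
  obtain ⟨φ, hφ⟩ := hc.exists_faceBoundary_eq hs hrev hcycle
  set X : Set D := {d | φ (G.faceOf d) = 1} with hX
  have hreg : G.IsRegion X := fun d => by simp only [hX, Set.mem_ofPred_eq, faceOf_next]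
  have hadd : ∀ a b : ZMod 2, ¬ (a = 1 ↔ b = 1) ↔ a + b = 1 := by decide
  have hborder : ∀ d, d ∈ G.border X ↔ z d = 1 := fun d => by rw [hφ, ← hadd]; rfl
  by_cases ho : o ∈ X
  · exact ⟨Xᶜ, hreg.compl, Set.notMem_compl_iff.2 ho, by rwa [border_compl]⟩
  · exact ⟨X, hreg, ho, hborder⟩

end Chains

section StrandLoops

variable (G : FourValentMap D)

/-- The strand that starts with `c` comes back to the initial vertex of `c` after `n` edges,
without visiting any other vertex twice. -/
structure IsStrandLoop (c : D) (n : ℕ) : Prop where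
  pos : 0 < n
  injOn : Set.InjOn (fun m => G.vertexOf ((G.straight ^ m) c)) (Set.Iio n)
  vertexOf_eq : G.vertexOf ((G.straight ^ n) c) = G.vertexOf c

/-- The first `i + n` vertices of the strand that starts with `d` are distinct, and the next one
is the `i`-th one again. -/
structure IsFirstReturn (d : D) (i n : ℕ) : Prop where
  pos : 0 < n
  injOn : Set.InjOn (fun m => G.vertexOf ((G.straight ^ m) d)) (Set.Iio (i + n))
  vertexOf_eq : G.vertexOf ((G.straight ^ (i + n)) d) = G.vertexOf ((G.straight ^ i) d)

theorem exists_isFirstReturn [Finite D] (d : D) : ∃ i n, G.IsFirstReturn d i n := by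
  classical
  have hreturn : ∃ j, ∃ i < j,
      G.vertexOf ((G.straight ^ i) d) = G.vertexOf ((G.straight ^ j) d) := by
    obtain ⟨i, j, hij, h⟩ :=
      Finite.exists_ne_map_eq_of_infinite fun m : ℕ => G.vertexOf ((G.straight ^ m) d)
    obtain hlt | hlt := hij.lt_or_gt
    exacts [⟨j, i, hlt, h⟩, ⟨i, j, hlt, h.symm⟩]
  obtain ⟨i, hi, h⟩ := Nat.find_spec hreturn
  obtain ⟨n, hn⟩ := Nat.exists_eq_add_of_le hi.le
  refine ⟨i, n, by omega, fun m hm m' hm' hv => ?_, by rw [← hn, h]⟩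
  rw [Set.mem_Iio, ← hn] at hm hm'
  obtain hlt | heq | hlt := lt_trichotomy m m'
  · exact absurd ⟨m, hlt, hv⟩ (Nat.find_min hreturn hm')
  · exact heq
  · exact absurd ⟨m', hlt, hv.symm⟩ (Nat.find_min hreturn hm)

variable {G}

theorem IsFirstReturn.isStrandLoop {d : D} {i n : ℕ} (h : G.IsFirstReturn d i n) :
    G.IsStrandLoop ((G.straight ^ i) d) n where
  pos := h.pos
  injOn m hm m' hm' hv := by
    simp only [← straight_pow_add] at hv
    exact Nat.add_left_cancel
      (h.injOn (Nat.add_lt_add_left hm i) (Nat.add_lt_add_left hm' i) hv)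
  vertexOf_eq := by rw [← straight_pow_add, h.vertexOf_eq]

theorem not_rot_eq_or_rot_eq_rot_rot {x e : D} (h : e = x ∨ e = G.rot (G.rot x)) :
    ¬ (G.rot e = x ∨ G.rot e = G.rot (G.rot x)) := by
  obtain rfl | rfl := h
  · exact not_or.2 ⟨G.rot_ne _, fun h => G.rot_ne _ h.symm⟩
  · exact not_or.2 ⟨G.rot_three_ne _, G.rot_ne _⟩

namespace IsStrandLoop

variable {c e : D} {n : ℕ} (h : G.IsStrandLoop c n)

include h

theorem eq_or_of_vertexOf_eq {m m' : ℕ} (hm : m ≤ n) (hm' : m' ≤ n)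
    (hv : G.vertexOf ((G.straight ^ m) c) = G.vertexOf ((G.straight ^ m') c)) :
    m = m' ∨ (m = 0 ∧ m' = n) ∨ (m = n ∧ m' = 0) := by
  obtain hm | rfl := hm.lt_or_eq <;> obtain hm' | rfl := hm'.lt_or_eq
  · exact Or.inl (h.injOn hm hm' hv)
  · exact Or.inr (Or.inl ⟨h.injOn hm h.pos (hv.trans h.vertexOf_eq), rfl⟩)
  · exact Or.inr (Or.inr ⟨rfl, h.injOn hm' h.pos (hv.symm.trans h.vertexOf_eq)⟩)
  · exact Or.inl rfl

theorem exists_lt_vertexOf_eq (he : e ∈ G.arc c n) :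
    ∃ k < n, G.vertexOf e = G.vertexOf ((G.straight ^ k) c) := by
  obtain ⟨m, hm, he⟩ := exists_vertex_of_mem_arc he
  have hv : G.vertexOf e = G.vertexOf ((G.straight ^ m) c) := by
    obtain ⟨-, rfl⟩ | ⟨-, rfl⟩ := he
    · rfl
    · rw [vertexOf_rot, vertexOf_rot]
  obtain hm | rfl := hm.lt_or_eq
  · exact ⟨m, hm, hv⟩
  · exact ⟨0, h.pos, hv.trans h.vertexOf_eq⟩

/-- The loop turns only where it closes. -/
theorem eq_of_rot_mem_arc (he : e ∈ G.arc c n) (he' : G.rot e ∈ G.arc c n) :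
    (e = c ∧ G.rot e = G.rot (G.rot ((G.straight ^ n) c))) ∨
      (G.rot e = c ∧ e = G.rot (G.rot ((G.straight ^ n) c))) := by
  obtain ⟨m, hm, hme⟩ := exists_vertex_of_mem_arc he
  obtain ⟨m', hm', hme'⟩ := exists_vertex_of_mem_arc he'
  have hv : G.vertexOf ((G.straight ^ m) c) = G.vertexOf ((G.straight ^ m') c) := by
    have hve : G.vertexOf e = G.vertexOf ((G.straight ^ m) c) := by
      obtain ⟨-, rfl⟩ | ⟨-, rfl⟩ := hme <;> simp only [vertexOf_rot]
    have hve' : G.vertexOf (G.rot e) = G.vertexOf ((G.straight ^ m') c) := by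
      obtain ⟨-, h'⟩ | ⟨-, h'⟩ := hme' <;> simp only [h', vertexOf_rot]
    rw [← hve, ← hve', vertexOf_rot]
  obtain rfl | ⟨rfl, rfl⟩ | ⟨rfl, rfl⟩ := h.eq_or_of_vertexOf_eq hm hm' hv
  · exact absurd (hme'.imp And.right And.right)
      (not_rot_eq_or_rot_eq_rot_rot (hme.imp And.right And.right))
  · obtain ⟨-, h1⟩ | ⟨h0, -⟩ := hme
    · obtain ⟨h0, -⟩ | ⟨-, h2⟩ := hme'
      · exact absurd h0 (lt_irrefl _)
      · exact Or.inl ⟨h1, h2⟩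
    · exact absurd h0 (lt_irrefl _)
  · obtain ⟨-, h2⟩ | ⟨h0, -⟩ := hme'
    · obtain ⟨h0, -⟩ | ⟨-, h1⟩ := hme
      · exact absurd h0 (lt_irrefl _)
      · exact Or.inr ⟨h2, h1⟩
    · exact absurd h0 (lt_irrefl _)

theorem rot_rot_notMem_arc (he : e ∈ G.arc c n) (he' : G.rot e ∈ G.arc c n) :
    G.rot (G.rot e) ∉ G.arc c n := fun he'' => by
  obtain ⟨h1, -⟩ | ⟨-, h2⟩ := h.eq_of_rot_mem_arc he he'
  · obtain ⟨h3, -⟩ | ⟨h3, -⟩ := h.eq_of_rot_mem_arc he' he''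
    · exact G.rot_ne e (h3.trans h1.symm)
    · exact G.rot_two_ne e (h3.trans h1.symm)
  · obtain ⟨-, h4⟩ | ⟨-, h4⟩ := h.eq_of_rot_mem_arc he' he''
    · exact G.rot_two_ne e (h4.trans h2.symm)
    · exact G.rot_ne e (h4.trans h2.symm)

theorem exists_isRegion_border_eq [Finite D] (hc : G.Connected) (hs : G.Spherical) (o : D) :
    ∃ X : Set D, G.IsRegion X ∧ o ∉ X ∧ G.border X = G.arc c n := by
  obtain ⟨X, hX, ho, hborder⟩ := hc.exists_isRegion_border_eq hs (G.arcChain_rev c n)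
    (fun e => by
      rw [boundary_arcChain, vertexChain, vertexChain, h.vertexOf_eq, CharTwo.add_self_eq_zero]) o
  exact ⟨X, hX, ho, Set.ext fun e => (hborder e).trans (G.arcChain_eq_one_iff
    (fun m hm m' hm' heq => h.injOn hm hm' (congrArg G.vertexOf heq)) e)⟩

variable {X : Set D} (hX : G.IsRegion X) (hborder : G.border X = G.arc c n)

include hborder

theorem nonempty : X.Nonempty := by
  have hmem : c ∈ G.border X := hborder ▸ ⟨0, h.pos, Or.inl rfl⟩
  by_contra hempty
  rw [Set.not_nonempty_iff_eq_empty] at hempty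
  exact hmem (by simp only [hempty, Set.mem_empty_iff_false])

include hX

theorem isConvex (henter : (G.straight ^ n) c = c ∨ G.rot (G.rot c) ∉ X) : G.IsConvex X := by
  intro e he he2
  by_contra he1
  have harc : e ∈ G.arc c n := hborder ▸ hX.mem_border.2 (by tauto)
  have harc1 : G.rot e ∈ G.arc c n := hborder ▸ hX.mem_border.2 (by tauto)
  have harc2 := h.rot_rot_notMem_arc harc harc1
  have he3 : G.rot (G.rot (G.rot e)) ∈ X := by
    rw [← hborder, hX.mem_border] at harc2
    tauto
  obtain ⟨h1, h2⟩ | ⟨h1, h2⟩ := h.eq_of_rot_mem_arc harc harc1 <;> obtain henter | henter := henter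
  · rw [henter, ← h1] at h2
    exact G.rot_ne _ h2.symm
  · exact henter (h1 ▸ he2)
  · rw [henter, ← h1] at h2
    exact G.rot_three_ne _ h2.symm
  · exact henter (h1 ▸ he3)

theorem corners_subsingleton : (G.corners X).Subsingleton := by
  have hcorner : ∀ e ∈ G.corners X,
      (G.rot (G.rot (G.rot e)) = c ∧ e = G.rot (G.rot ((G.straight ^ n) c))) ∨
        (e = c ∧ G.rot (G.rot (G.rot e)) = G.rot (G.rot ((G.straight ^ n) c))) := by
    rintro e ⟨h0, h1, h3⟩
    have harc : e ∈ G.arc c n := hborder ▸ hX.mem_border.2 (by tauto)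
    have harc3 : G.rot (G.rot (G.rot e)) ∈ G.arc c n :=
      hborder ▸ hX.mem_border.2 (by rw [G.rot_four]; tauto)
    have := h.eq_of_rot_mem_arc harc3 (by rwa [G.rot_four])
    rwa [G.rot_four] at this
  have hmixed : ∀ {e e'}, G.rot (G.rot (G.rot e)) = e' → G.rot (G.rot (G.rot e')) ≠ e := by
    rintro e _ rfl
    rw [G.rot_four]
    exact G.rot_two_ne e
  intro e he e' he'
  obtain ⟨h1, h2⟩ | ⟨h1, h2⟩ := hcorner e he <;> obtain ⟨h3, h4⟩ | ⟨h3, h4⟩ := hcorner e' he'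
  · rw [h2, h4]
  · exact absurd (h4.trans h2.symm) (hmixed (h1.trans h3.symm))
  · exact absurd (h2.trans h4.symm) (hmixed (h3.trans h1.symm))
  · rw [h1, h3]

end IsStrandLoop

theorem IsRegion.rot_rot_straight_pow_notMem {X : Set D} (hX : G.IsRegion X) {d : D} {i : ℕ}
    (hoff : ∀ m < i, ∀ e, G.vertexOf e = G.vertexOf ((G.straight ^ m) d) → e ∉ G.border X)
    (hd : G.rot (G.rot d) ∉ X) : G.rot (G.rot ((G.straight ^ i) d)) ∉ X := by
  induction i with
  | zero => exact hd
  | succ i ih =>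
    set e := (G.straight ^ i) d
    have hstep : ∀ x, G.vertexOf x = G.vertexOf e → x ∉ X → G.rot x ∉ X := fun x hx hxX hxX' =>
      hoff i i.lt_succ_self x hx (hX.mem_border.2 (by tauto))
    have he2 := ih fun m hm => hoff m (hm.trans i.lt_succ_self)
    have he3 := hstep _ (by simp only [vertexOf_rot]) he2
    have he := hstep _ (by simp only [vertexOf_rot]) he3
    rw [G.rot_four] at he
    rw [← rev_straight_pow, rev_mem_iff_of_notMem_border (hoff i i.lt_succ_self e rfl)]
    exact he

/-- The strand cannot enter the loop from inside, because its tail does not meet the loop. -/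
theorem IsFirstReturn.enters {d : D} {i n : ℕ} (h : G.IsFirstReturn (G.straight d) i n) {X : Set D}
    (hX : G.IsRegion X)
    (hborder : G.border X = G.arc ((G.straight ^ i) (G.straight d)) n) (hd : d ∉ X) :
    (G.straight ^ n) ((G.straight ^ i) (G.straight d)) = (G.straight ^ i) (G.straight d) ∨
      G.rot (G.rot ((G.straight ^ i) (G.straight d))) ∉ X := by
  set c := (G.straight ^ i) (G.straight d) with hcd
  have htail : ∀ m < i, ∀ e, G.vertexOf e = G.vertexOf ((G.straight ^ m) (G.straight d)) →
      e ∉ G.border X := by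
    intro m hm e hv he
    obtain ⟨k, hk, hv'⟩ := h.isStrandLoop.exists_lt_vertexOf_eq (hborder ▸ he)
    rw [← straight_pow_add] at hv'
    have := h.injOn (Set.mem_Iio.2 (by omega)) (Set.mem_Iio.2 (by omega)) (hv.symm.trans hv')
    omega
  by_cases hdX : d ∈ G.border X
  · obtain ⟨m, hm, hd' | hd'⟩ := hborder ▸ hdX
    · have hmc : G.straight d = (G.straight ^ (m + 1)) c := by rw [straight_pow_succ, ← hd']
      have hi : i = 0 := by
        by_contra hi
        obtain ⟨k, hk, hv⟩ := h.isStrandLoop.exists_lt_vertexOf_eq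
          (e := G.rev d) ⟨m, hm, Or.inr (congrArg G.rev hd')⟩
        rw [← vertexOf_straight, ← straight_pow_add] at hv
        have := h.injOn (Set.mem_Iio.2 (by omega : 0 < i + n)) (Set.mem_Iio.2 (by omega)) hv
        omega
      have hc : c = G.straight d := by rw [hcd, hi, pow_zero, Equiv.Perm.one_apply]
      have hmn := h.isStrandLoop.eq_or_of_vertexOf_eq (m := 0) (m' := m + 1) (by omega) (by omega)
        (congrArg G.vertexOf (hc.trans hmc))
      obtain rfl : m + 1 = n := by omega
      exact Or.inl (hmc.symm.trans hc.symm)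
    · refine absurd ?_ (G.straight_pow_ne_rev (1 + i + m) d)
      rw [straight_pow_add, straight_pow_add, pow_one, ← hcd, ← G.rev_rev ((G.straight ^ m) c),
        ← hd']
  · refine Or.inr (hX.rot_rot_straight_pow_notMem htail ?_)
    rwa [rot_rot_straight, rev_mem_iff_of_notMem_border hdX]

theorem IsFirstReturn.exists_convex [Finite D] (hc : G.Connected) (hs : G.Spherical) {d o : D}
    {i n : ℕ} (h : G.IsFirstReturn (G.straight d) i n)
    (hd : ∀ X, G.IsRegion X → G.border X = G.arc ((G.straight ^ i) (G.straight d)) n → o ∉ X →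
      d ∉ X) :
    ∃ X, G.IsRegion X ∧ G.IsConvex X ∧ X.Nonempty ∧ (G.corners X).ncard ≤ 1 ∧ o ∉ X ∧
      G.border X = G.arc ((G.straight ^ i) (G.straight d)) n := by
  have hloop := h.isStrandLoop
  obtain ⟨X, hX, ho, hborder⟩ := hloop.exists_isRegion_border_eq hc hs o
  exact ⟨X, hX, hloop.isConvex hX hborder (h.enters hX hborder (hd X hX hborder ho)),
    hloop.nonempty hborder, Set.ncard_le_one_iff_subsingleton.2
      (hloop.corners_subsingleton hX hborder), ho, hborder⟩

theorem exists_convex_of_mem_component [Finite D] (hc : G.Connected) (hs : G.Spherical) {d o : D}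
    (hd : d ∈ G.component (G.strand d) o) :
    ∃ X, G.IsRegion X ∧ G.IsConvex X ∧ X.Nonempty ∧ (G.corners X).ncard ≤ 1 ∧ o ∉ X ∧
      G.border X ⊆ G.strand d := by
  obtain ⟨i, n, h⟩ := G.exists_isFirstReturn (G.straight d)
  have hsub : G.arc ((G.straight ^ i) (G.straight d)) n ⊆ G.strand d := by
    refine (arc_subset_strand _ _).trans (strand_eq_of_sameCycle ?_).le
    exact ⟨i + 1, by
      rw [zpow_add, zpow_natCast, zpow_one, Equiv.Perm.mul_apply]⟩
  obtain ⟨X, hX, hconv, hne, hcorner, ho, hborder⟩ := h.exists_convex hc hs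
    fun X hX hborder ho hdX => hd Xᶜ hX.compl ho (by rwa [border_compl, hborder]) hdX
  exact ⟨X, hX, hconv, hne, hcorner, ho, hborder ▸ hsub⟩

/-- Some face next to the strand lies in the component of `o`. -/
theorem exists_convex_of_strand [Finite D] (hc : G.Connected) (hs : G.Spherical) (d o : D) :
    ∃ X, G.IsRegion X ∧ G.IsConvex X ∧ X.Nonempty ∧ (G.corners X).ncard ≤ 1 ∧ o ∉ X ∧
      G.border X ⊆ G.strand d := by
  set K := G.component (G.strand d) o with hK
  by_cases hmeet : ∃ e ∈ G.strand d, e ∈ K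
  · obtain ⟨e, hed, heK⟩ := hmeet
    rw [← strand_eq_of_mem hed] at hK ⊢
    exact exists_convex_of_mem_component hc hs (hK ▸ heK)
  · push Not at hmeet
    have huniv : K = Set.univ := hc.eq_univ_of_mapsTo_next
      (fun e he => (isRegion_component _ _ e).2 he)
      (fun e he => (rev_mem_component_iff fun hed => hmeet e hed he).2 he)
      ⟨o, self_mem_component _ _⟩
    exact absurd (huniv ▸ Set.mem_univ d) (hmeet d (G.self_mem_strand d))

end StrandLoops

/-! ### Minimal lenses -/

section Discs

variable (G : FourValentMap D)

/-- The darts of the edges with both sides in `T`. -/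
def inner (T : Set D) : Set D := {d | d ∈ T ∧ G.rev d ∈ T}

/-- The complement of the region `T` is connected. -/
def IsCoconnected (T : Set D) : Prop := ∀ o ∉ T, Tᶜ ⊆ G.component (G.border T) o

/-- The region `T` together with all components of its complement except the one containing
`o`. -/
def fill (o : D) (T : Set D) : Set D := (G.component (G.border T) o)ᶜ

/-- A nonempty convex region with connected complement, this complement containing the face to the
left of `o`, which plays the role of the outer face. -/
structure IsDisc (o : D) (T : Set D) : Prop where
  region : G.IsRegion T
  convex : G.IsConvex T
  nonempty : T.Nonempty
  coconnected : G.IsCoconnected T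
  notMem : o ∉ T

/-- A smallest disc with at most two corners. -/
structure IsMinimalLens (o : D) (S : Set D) : Prop extends G.IsDisc o S where
  ncard_corners_le : (G.corners S).ncard ≤ 2
  ncard_le : ∀ T, G.IsDisc o T → (G.corners T).ncard ≤ 2 → S.ncard ≤ T.ncard

variable {G} {o : D} {S T X : Set D}

theorem rev_mem_inner {d : D} : G.rev d ∈ G.inner T ↔ d ∈ G.inner T := by
  rw [inner, Set.mem_ofPred_eq, Set.mem_ofPred_eq, G.rev_rev, and_comm]

theorem IsRegion.mem_inner (hT : G.IsRegion T) {d : D} :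
    d ∈ G.inner T ↔ d ∈ T ∧ G.rot d ∈ T :=
  and_congr_right fun _ => hT.rev_mem d

theorem arc_subset_inner {d : D} {n : ℕ} (h : ∀ m < n, (G.straight ^ m) d ∈ G.inner T) :
    G.arc d n ⊆ G.inner T := by
  rintro _ ⟨m, hm, rfl | rfl⟩
  · exact h m hm
  · exact rev_mem_inner.2 (h m hm)

theorem IsCoconnected.compl_subset (hT : G.IsCoconnected T) (hreg : G.IsRegion T)
    (hX : G.IsRegion X) (hborder : ∀ d ∈ G.border X, d ∈ T ∨ G.rev d ∈ T) (ho : o ∉ T)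
    (hoX : o ∈ X) : Tᶜ ⊆ X := by
  intro e he
  have hunion : G.border (X ∪ T) ⊆ G.border T := by
    refine (border_subset_iff fun _ => rev_mem_border).2 fun d hd hd' => ?_
    have hd'T : G.rev d ∉ T := fun h => hd' (Or.inr h)
    obtain hd | hd := hd
    · have hdX := mem_border_of_mem hd fun h => hd' (Or.inl h)
      exact mem_border_of_mem ((hborder d hdX).resolve_right hd'T) hd'T
    · exact mem_border_of_mem hd hd'T
  exact (component_subset (hX.union hreg) (Or.inl hoX) hunion (hT o ho he)).resolve_right he

theorem subset_fill (hT : G.IsRegion T) (ho : o ∉ T) : T ⊆ G.fill o T :=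
  Set.subset_compl_comm.1 (component_subset hT.compl ho (border_compl T).le)

theorem notMem_fill : o ∉ G.fill o T := Set.notMem_compl_iff.2 (self_mem_component _ _)

theorem isRegion_fill : G.IsRegion (G.fill o T) := (isRegion_component _ _).compl

theorem mem_of_mem_fill_of_rev_notMem {e : D} (hT : G.IsRegion T) (ho : o ∉ T)
    (he : e ∈ G.fill o T) (he' : G.rev e ∉ G.fill o T) : e ∈ T := by
  by_contra heT
  have hborder := notMem_border heT fun h => he' (subset_fill hT ho h)
  exact he ((rev_mem_component_iff hborder).1 (Set.notMem_compl_iff.1 he'))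

theorem isConvex_fill (hT : G.IsRegion T) (hconv : G.IsConvex T) (ho : o ∉ T) :
    G.IsConvex (G.fill o T) := by
  intro e he he2
  by_contra he1
  have h0 : e ∈ T := mem_of_mem_fill_of_rev_notMem hT ho he (by rwa [isRegion_fill.rev_mem])
  have h2 : G.rot (G.rot e) ∈ T := by
    rw [← hT.rev_mem]
    refine mem_of_mem_fill_of_rev_notMem hT ho ?_ (by rwa [G.rev_rev])
    rwa [isRegion_fill.rev_mem]
  exact he1 (subset_fill hT ho (hconv e h0 h2))

theorem corners_fill_subset (hT : G.IsRegion T) (ho : o ∉ T) :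
    G.corners (G.fill o T) ⊆ G.corners T := fun _ ⟨h0, h1, h3⟩ =>
  ⟨mem_of_mem_fill_of_rev_notMem hT ho h0 (by rwa [isRegion_fill.rev_mem]),
    fun h => h1 (subset_fill hT ho h), fun h => h3 (subset_fill hT ho h)⟩

theorem isCoconnected_fill : G.IsCoconnected (G.fill o T) := by
  set K := G.component (G.border T) o
  have hK : G.IsRegion K := isRegion_component _ _
  have hsub : ∀ X, G.IsRegion X → G.border X ⊆ G.border Kᶜ → o ∈ X → K ⊆ X := by
    intro X hX hborder ho
    have hinter : G.border (X ∩ K) ⊆ G.border T := by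
      refine (border_subset_iff fun _ => rev_mem_border).2 fun d hd hd' => ?_
      by_contra hdT
      have hd'K : G.rev d ∈ K := (rev_mem_component_iff hdT).2 hd.2
      have hdX := hborder (mem_border_of_mem hd.1 fun h => hd' ⟨h, hd'K⟩)
      rw [border_compl] at hdX
      exact hdX (iff_of_true hd.2 hd'K)
    exact (component_subset (hX.inter hK) ⟨ho, self_mem_component _ _⟩ hinter).trans
      Set.inter_subset_left
  intro p hp e he X hX hpX hborder
  rw [fill, Set.notMem_compl_iff] at hp
  rw [fill, compl_compl] at he
  by_cases ho : o ∈ X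
  · exact hsub X hX hborder ho he
  · exact absurd hpX (hsub Xᶜ hX.compl (by rwa [border_compl]) ho hp)

theorem isDisc_fill (hT : G.IsRegion T) (hconv : G.IsConvex T) (hne : T.Nonempty) (ho : o ∉ T) :
    G.IsDisc o (G.fill o T) :=
  ⟨isRegion_fill, isConvex_fill hT hconv ho, hne.mono (subset_fill hT ho), isCoconnected_fill,
    notMem_fill⟩

theorem ncard_corners_fill_le [Finite D] (hT : G.IsRegion T) (ho : o ∉ T) :
    (G.corners (G.fill o T)).ncard ≤ (G.corners T).ncard :=
  Set.ncard_le_ncard (corners_fill_subset hT ho)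

namespace IsDisc

theorem fill_subset (hS : G.IsDisc o S) (hTS : T ⊆ S) : G.fill o T ⊆ S :=
  Set.compl_subset_comm.1 fun _ he X hX ho hborder =>
    hS.coconnected.compl_subset hS.region hX (fun d hd => by
      have : ¬ (d ∈ T ↔ G.rev d ∈ T) := hborder hd
      have := @hTS d
      have := @hTS (G.rev d)
      tauto) hS.notMem ho he

theorem exists_mem_rev_notMem [Finite D] (hc : G.Connected) (hS : G.IsDisc o S) :
    ∃ b ∈ S, G.rev b ∉ S := by
  by_contra! hcon
  exact hS.notMem (hc.eq_univ_of_mapsTo_next (fun d hd => (hS.region d).2 hd) hcon hS.nonempty ▸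
    Set.mem_univ o)

theorem subset_of_border_subset_inner (hS : G.IsDisc o S) (hX : G.IsRegion X) (ho : o ∉ X)
    (hborder : G.border X ⊆ G.inner S) : X ⊆ S :=
  Set.compl_subset_compl.1 (hS.coconnected.compl_subset hS.region hX.compl
    (fun d hd => Or.inl (hborder (by rwa [border_compl] at hd)).1) hS.notMem ho)

end IsDisc

theorem exists_isMinimalLens [Finite D] (hT : G.IsRegion T) (hconv : G.IsConvex T)
    (hne : T.Nonempty) (ho : o ∉ T) (hcard : (G.corners T).ncard ≤ 2) :
    ∃ S, G.IsMinimalLens o S ∧ S.ncard ≤ (G.fill o T).ncard := by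
  obtain ⟨S, ⟨hS, hScard⟩, hmin⟩ := Set.exists_min_image
    {S : Set D | G.IsDisc o S ∧ (G.corners S).ncard ≤ 2} Set.ncard (Set.toFinite _)
    ⟨_, isDisc_fill hT hconv hne ho, (ncard_corners_fill_le hT ho).trans hcard⟩
  exact ⟨S, ⟨hS, hScard, fun T' hT' hcard' => hmin T' ⟨hT', hcard'⟩⟩,
    hmin _ ⟨isDisc_fill hT hconv hne ho, (ncard_corners_fill_le hT ho).trans hcard⟩⟩

namespace IsMinimalLens

variable (hS : G.IsMinimalLens o S)

include hS

theorem three_le_ncard_corners_fill [Finite D] (hT : G.IsDisc o T) (hTS : T ⊆ S) (hXT : X ⊆ T)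
    (hX : G.IsRegion X) (hconv : G.IsConvex X) (hne : X.Nonempty)
    (hborder : ∃ b ∈ T, G.rev b ∉ T ∧ b ∉ X) : 3 ≤ (G.corners (G.fill o X)).ncard := by
  obtain ⟨b, hb, hb', hbX⟩ := hborder
  by_contra hlt
  have ho : o ∉ X := fun h => hT.notMem (hXT h)
  have hXfill := hT.fill_subset hXT
  have hle := hS.ncard_le _ (isDisc_fill hX hconv hne ho) (by omega)
  have hfill : G.fill o X = S := Set.eq_of_subset_of_ncard_le (hXfill.trans hTS) hle
  obtain rfl : T = S := hTS.antisymm (hfill ▸ hXfill)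
  rw [← hfill] at hb hb'
  exact hbX (mem_of_mem_fill_of_rev_notMem hX ho hb hb')

theorem not_border_subset_inner [Finite D] (hc : G.Connected) (hX : G.IsRegion X)
    (hconv : G.IsConvex X) (hne : X.Nonempty) (hcard : (G.corners X).ncard ≤ 1) (ho : o ∉ X) :
    ¬ G.border X ⊆ G.inner S := fun hborder => by
  have hXS := hS.subset_of_border_subset_inner hX ho hborder
  obtain ⟨b, hb, hb'⟩ := hS.exists_mem_rev_notMem hc
  have hbX : b ∉ X := fun h => hb' (hborder (mem_border_of_mem h fun h' => hb' (hXS h'))).2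
  have := hS.three_le_ncard_corners_fill hS.toIsDisc subset_rfl hXS hX hconv hne ⟨b, hb, hb', hbX⟩
  have := ncard_corners_fill_le hX ho
  omega

theorem not_strand_subset_inner [Finite D] (hc : G.Connected) (hs : G.Spherical) (d : D) :
    ¬ G.strand d ⊆ G.inner S := fun hd => by
  obtain ⟨X, hX, hconv, hne, hcard, ho, hborder⟩ := exists_convex_of_strand hc hs d o
  exact hS.not_border_subset_inner hc hX hconv hne hcard ho (hborder.trans hd)

end IsMinimalLens

theorem rot_three_notMem (hconv : G.IsConvex T) {d : D} (h1 : G.rot d ∈ T)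
    (h2 : G.rot (G.rot d) ∉ T) : G.rot (G.rot (G.rot d)) ∉ T := fun h => h2 (hconv _ h1 h)

theorem straight_mem_inner (hT : G.IsRegion T) (hconv : G.IsConvex T) {d : D}
    (hd : G.rev d ∈ T) (hd' : G.straight d ∈ T) : G.straight d ∈ G.inner T :=
  hT.mem_inner.2 ⟨hd', hconv _ hd' (by rwa [rot_rot_straight])⟩

theorem mem_inner_of_straight_mem (hT : G.IsRegion T) (hconv : G.IsConvex T) {d : D}
    (hd : G.straight d ∈ T) (hd' : G.rev d ∈ T) : d ∈ G.inner T := by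
  refine ⟨(hT.rot_three_straight_mem d).1 ?_, hd'⟩
  exact hconv _ (by rwa [rot_rot_straight]) (by rwa [G.rot_four])

theorem straight_pow_mem_inner (hT : G.IsRegion T) (hconv : G.IsConvex T) {d : D}
    (hd : G.rev d ∈ T) {n : ℕ} (h : ∀ m < n, (G.straight ^ m) d ∈ T) :
    ∀ m < n, (G.straight ^ m) d ∈ G.inner T := by
  intro m hm
  induction m with
  | zero => exact ⟨h 0 hm, hd⟩
  | succ m ih =>
    have := h _ hm
    rw [straight_pow_succ] at this ⊢
    exact straight_mem_inner hT hconv (ih (by omega)).2 this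

theorem exists_straight_pow_eq_of_mem_strand [Finite D] {d e : D} (he : e ∈ G.strand d) :
    ∃ k, (G.straight ^ k) e = d ∨ (G.straight ^ k) (G.rev e) = d := by
  obtain he | he := he
  · exact he.symm.exists_nat_pow_eq.imp fun _ => Or.inl
  · exact he.symm.exists_nat_pow_eq.imp fun _ => Or.inr

namespace IsMinimalLens

variable [Finite D] (hc : G.Connected) (hs : G.Spherical) (hS : G.IsMinimalLens o S)

include hc hs hS

/-- Followed backwards, the strand reaches the boundary, because no strand stays inside. -/
theorem exists_start {d : D} (hd : d ∈ G.inner S) :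
    ∃ e k, (G.straight ^ k) e = d ∧ (∀ m ≤ k, (G.straight ^ m) e ∈ G.inner S) ∧
      G.rot (G.rot e) ∉ S := by
  by_contra! hcon
  have hback : ∀ k e, (G.straight ^ k) e = d →
      ∀ m ≤ k, (G.straight ^ m) e ∈ G.inner S := by
    intro k
    induction k with
    | zero =>
      rintro e rfl m hm
      rwa [Nat.le_zero.1 hm]
    | succ k ih =>
      intro e he m hm
      rw [← straight_pow_straight] at he
      have hrev := hcon _ k he (ih _ he)
      rw [rot_rot_straight] at hrev
      obtain - | m := m
      · exact mem_inner_of_straight_mem hS.region hS.convex (ih _ he 0 k.zero_le).1 hrev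
      · rw [← straight_pow_straight]
        exact ih _ he m (by omega)
  refine hS.not_strand_subset_inner hc hs d fun e he => ?_
  obtain ⟨k, hk | hk⟩ := exists_straight_pow_eq_of_mem_strand he
  · exact hback k e hk 0 k.zero_le
  · exact rev_mem_inner.1 (hback k _ hk 0 k.zero_le)

theorem injOn_vertexOf_of_start {d : D} {n : ℕ} (hd : ∀ m < n, (G.straight ^ m) d ∈ G.inner S)
    (hd2 : G.rot (G.rot d) ∉ S) :
    Set.InjOn (fun m => G.vertexOf ((G.straight ^ m) d)) (Set.Ico 1 n) := by
  obtain ⟨i, k, h⟩ := G.exists_isFirstReturn (G.straight d)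
  obtain hlt | hle := lt_or_ge (i + 1 + k) n
  · have harc : G.arc ((G.straight ^ i) (G.straight d)) k ⊆ G.inner S := by
      refine arc_subset_inner fun m hm => ?_
      rw [straight_pow_straight, ← straight_pow_add]
      exact hd _ (by omega)
    have h3 := rot_three_notMem hS.convex (hS.region.mem_inner.1 (hd 0 (by omega))).2 hd2
    obtain ⟨X, hX, hconv, hne, hcard, ho, hborder⟩ := h.exists_convex (o := o) hc hs
      fun X hX hborder ho hdX => by
        have hinner : G.border X ⊆ G.inner S := hborder ▸ harc
        refine h3 (hinner ((hX.mem_border).2 fun hiff => ?_)).1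
        rw [G.rot_four] at hiff
        exact h3 (hS.subset_of_border_subset_inner hX ho hinner (hiff.2 hdX))
    exact absurd (hborder ▸ harc) (hS.not_border_subset_inner hc hX hconv hne hcard ho)
  · rintro m ⟨hm, hmn⟩ m' ⟨hm', hmn'⟩ hv
    obtain ⟨m, rfl⟩ := Nat.exists_eq_add_of_le' hm
    obtain ⟨m', rfl⟩ := Nat.exists_eq_add_of_le' hm'
    simp only [← straight_pow_straight] at hv
    exact congrArg (· + 1) (h.injOn (by rw [Set.mem_Iio]; omega) (by rw [Set.mem_Iio]; omega) hv)

theorem injOn_vertexOf {d : D} {n : ℕ} (hd : ∀ m < n, (G.straight ^ m) d ∈ G.inner S) :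
    Set.InjOn (fun m => G.vertexOf ((G.straight ^ m) d)) (Set.Ico 1 n) := by
  rintro m ⟨hm, hmn⟩ m' ⟨hm', hmn'⟩ hv
  obtain ⟨e, k, rfl, he, he2⟩ := exists_start hc hs hS (hd 0 (by omega))
  simp only [← straight_pow_add] at hd hv
  have hinj := injOn_vertexOf_of_start hc hs hS (n := k + n) (fun t ht => by
    obtain hle | hlt := le_or_gt t k
    · exact he t hle
    · obtain ⟨r, rfl⟩ := Nat.exists_eq_add_of_le hlt.le
      exact hd r (by omega)) he2
  have := hinj (show k + m ∈ _ from ⟨by omega, by omega⟩)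
    (show k + m' ∈ _ from ⟨by omega, by omega⟩) hv
  omega

end IsMinimalLens

end Discs

/-! ### Chords of discs -/

section Chords

variable {G : FourValentMap D} {T X : Set D} {d e : D} {n : ℕ}

variable (G) in
/-- The first `n` edges of the strand that starts with `d` run inside the convex region `T` from
boundary to boundary. -/
structure IsChord (T : Set D) (d : D) (n : ℕ) : Prop where
  isRegion : G.IsRegion T
  isConvex : G.IsConvex T
  rot_rot_notMem : G.rot (G.rot d) ∉ T
  pos : 0 < n
  mem_inner : ∀ m < n, (G.straight ^ m) d ∈ G.inner T
  notMem : (G.straight ^ n) d ∉ T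

theorem exists_isChord [Finite D] (hT : G.IsRegion T) (hconv : G.IsConvex T)
    (hd : d ∈ G.inner T) (hd2 : G.rot (G.rot d) ∉ T) : ∃ n, G.IsChord T d n := by
  classical
  have hex : ∃ n, (G.straight ^ n) d ∉ T := by
    obtain ⟨k, hk⟩ := (Equiv.Perm.sameCycle_apply_left.2
      (Equiv.Perm.SameCycle.refl G.straight d)).exists_nat_pow_eq
    refine ⟨k, fun h => rot_three_notMem hconv (hT.mem_inner.1 hd).2 hd2 ?_⟩
    nth_rw 1 [← hk]
    rwa [straight_pow_straight, straight_pow_succ, hT.rot_three_straight_mem]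
  exact ⟨Nat.find hex, hT, hconv, hd2, (Nat.find_pos hex).2 (not_not.2 hd.1),
    straight_pow_mem_inner hT hconv hd.2 fun m hm => not_not.1 (Nat.find_min hex hm),
    Nat.find_spec hex⟩

theorem rot_notMem_arc (hinj : Set.InjOn (fun m => G.vertexOf ((G.straight ^ m) d)) (Set.Iic n))
    (he : e ∈ G.arc d n) : G.rot e ∉ G.arc d n := fun he' => by
  obtain ⟨m, hm, hem⟩ := exists_vertex_of_mem_arc he
  obtain ⟨m', hm', hem'⟩ := exists_vertex_of_mem_arc he'
  have hv : G.vertexOf ((G.straight ^ m) d) = G.vertexOf e := by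
    obtain ⟨-, rfl⟩ | ⟨-, rfl⟩ := hem <;> simp only [vertexOf_rot]
  have hv' : G.vertexOf ((G.straight ^ m') d) = G.vertexOf (G.rot e) := by
    obtain ⟨-, h⟩ | ⟨-, h⟩ := hem' <;> simp only [h, vertexOf_rot]
  obtain rfl := hinj hm hm' (by simp only [hv, hv', vertexOf_rot])
  exact not_rot_eq_or_rot_eq_rot_rot (hem.imp And.right And.right) (hem'.imp And.right And.right)

variable (G) in
/-- The last dart of the first `n` edges of the strand of `d`, reversed. -/
def arcEnd (d : D) (n : ℕ) : D := G.rot (G.rot ((G.straight ^ n) d))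

theorem rot_rot_arcEnd : G.rot (G.rot (G.arcEnd d n)) = (G.straight ^ n) d := G.rot_four _

namespace IsChord

variable (h : G.IsChord T d n)

include h

theorem self_mem_inner : d ∈ G.inner T := h.mem_inner 0 h.pos

theorem self_mem_arc : d ∈ G.arc d n := ⟨0, h.pos, Or.inl rfl⟩

theorem vertex_mem {m : ℕ} (h0 : 0 < m) (hm : m < n)
    (he : G.vertexOf ((G.straight ^ m) d) = G.vertexOf e) : e ∈ T := by
  have hmem := h.mem_inner m hm
  obtain ⟨k, rfl⟩ := Nat.exists_eq_add_of_le' h0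
  have hk := h.mem_inner k (by omega)
  obtain rfl | rfl | rfl | rfl := (G.vertexOf_eq_iff _ _).1 he
  · exact hmem.1
  · exact (h.isRegion.mem_inner.1 hmem).2
  · rw [← rev_straight_pow]
    exact hk.2
  · rw [straight_pow_succ, h.isRegion.rot_three_straight_mem]
    exact hk.1

theorem arcEnd_eq : G.arcEnd d n = G.rev ((G.straight ^ (n - 1)) d) := by
  rw [arcEnd, rev_straight_pow, Nat.sub_add_cancel h.pos]

theorem arcEnd_mem_arc : G.arcEnd d n ∈ G.arc d n :=
  ⟨n - 1, Nat.sub_lt h.pos one_pos, Or.inr h.arcEnd_eq⟩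

theorem arcEnd_mem_inner : G.arcEnd d n ∈ G.inner T :=
  arc_subset_inner h.mem_inner h.arcEnd_mem_arc

theorem arcEnd_ne : G.arcEnd d n ≠ d := fun heq =>
  G.straight_pow_ne_rev_pow 0 (n - 1) d (heq.symm.trans h.arcEnd_eq)

theorem vertexOf_end_ne : G.vertexOf d ≠ G.vertexOf ((G.straight ^ n) d) := fun hv => by
  have hd := h.isRegion.mem_inner.1 h.self_mem_inner
  have hend := h.isRegion.mem_inner.1 h.arcEnd_mem_inner
  obtain heq | heq | heq | heq := (G.vertexOf_eq_iff _ _).1 hv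
  · exact h.notMem (by rw [heq]; exact hd.1)
  · exact h.notMem (by rw [heq]; exact hd.2)
  · exact h.arcEnd_ne (by rw [arcEnd, heq, G.rot_four])
  · refine h.rot_rot_notMem ?_
    rw [arcEnd, heq, G.rot_four] at hend
    exact hend.2

theorem injOn (hinj : Set.InjOn (fun m => G.vertexOf ((G.straight ^ m) d)) (Set.Ico 1 n)) :
    Set.InjOn (fun m => G.vertexOf ((G.straight ^ m) d)) (Set.Iic n) := by
  intro m hm m' hm' hv
  wlog hle : m ≤ m' generalizing m m'
  · exact (this hm' hm hv.symm (by omega)).symm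
  obtain rfl | hlt := hle.eq_or_lt
  · rfl
  obtain rfl | hm'n := (Set.mem_Iic.1 hm').eq_or_lt
  · obtain rfl | h0 := m.eq_zero_or_pos
    · exact absurd hv h.vertexOf_end_ne
    · exact absurd (h.vertex_mem h0 hlt hv) h.notMem
  · obtain rfl | h0 := m.eq_zero_or_pos
    · exact absurd (h.vertex_mem hlt hm'n (hv.symm.trans (by simp only [vertexOf_rot]; rfl)))
        h.rot_rot_notMem
    · exact hinj ⟨h0, by omega⟩ ⟨by omega, hm'n⟩ hv

theorem eq_or_eq_of_mem_arc (he : e ∈ G.arc d n) (he2 : G.rot (G.rot e) ∉ T) :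
    e = d ∨ e = G.arcEnd d n := by
  obtain ⟨m, hm, ⟨hmn, rfl⟩ | ⟨h0, rfl⟩⟩ := exists_vertex_of_mem_arc he
  · refine Or.inl (by_contra fun hne => he2 (h.vertex_mem (m := m) ?_ hmn ?_))
    · exact Nat.pos_of_ne_zero fun h0 => hne (by rw [h0]; rfl)
    · simp only [vertexOf_rot]
  · refine Or.inr (by_contra fun hne => he2 (h.vertex_mem (m := m) h0 ?_ ?_))
    · exact hm.lt_of_ne fun hmn => hne (by rw [hmn, arcEnd])
    · simp only [vertexOf_rot]

end IsChord

section Separation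

variable (G) in
/-- The vertices of `x` and `y` bound a chain modulo `2` of edges with at most one side in `T`. -/
def IsLinked (T : Set D) (x y : D) : Prop :=
  ∃ z : D → ZMod 2, (∀ a, z (G.rev a) = z a) ∧ (∀ a ∈ G.inner T, z a = 0) ∧
    ∀ a, G.boundary z a = G.vertexChain x a + G.vertexChain y a

theorem vertexChain_congr {x y : D} (hv : G.vertexOf x = G.vertexOf y) :
    G.vertexChain x = G.vertexChain y := by
  funext a
  rw [vertexChain, hv, vertexChain]

theorem IsLinked.congr {x y y' : D} (h : G.IsLinked T x y) (hv : G.vertexOf y = G.vertexOf y') :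
    G.IsLinked T x y' := by
  rwa [IsLinked, ← vertexChain_congr hv]

theorem isLinked_self (T : Set D) (x : D) : G.IsLinked T x x :=
  ⟨0, fun _ => rfl, fun _ _ => rfl, fun a => by
    simp [boundary, CharTwo.add_self_eq_zero]⟩

theorem IsLinked.rev [Finite D] {x y : D} (h : G.IsLinked T x y) (hy : y ∉ G.inner T) :
    G.IsLinked T x (G.rev y) := by
  obtain ⟨z, hrev, hinner, hz⟩ := h
  refine ⟨fun a => z a + G.edgeChain y a, fun a => ?_, fun a ha => ?_, fun a => ?_⟩
  · simp only [hrev, edgeChain_rev]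
  · simp only [hinner a ha, zero_add]
    refine if_neg fun hya => hy ?_
    obtain rfl | rfl := (G.edgeOf_eq_iff _ _).1 hya
    · exact ha
    · exact rev_mem_inner.1 ha
  · rw [boundary_add, hz, boundary_edgeChain, add_assoc, CharTwo.add_cancel_left]

theorem IsCoconnected.isLinked [Finite D] (hco : G.IsCoconnected T) (hT : G.IsRegion T) {x y : D}
    (hx : x ∉ T) (hy : y ∉ T) : G.IsLinked T x y := by
  have hnext : ∀ e, G.vertexOf (G.next e) = G.vertexOf (G.rev e) := fun e => by
    rw [next_apply, vertexOf_rot]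
  have hreg : G.IsRegion {e | e ∉ T ∧ G.IsLinked T x e} := fun e =>
    and_congr (not_congr (hT e)) |> fun hcongr => by
      by_cases he : e ∈ T
      · exact iff_of_false (fun h => h.1 ((hT e).2 he)) fun h => h.1 he
      refine hcongr ⟨fun h => ?_, fun h => ?_⟩
      · have hrev := (h.congr (hnext e)).rev fun h' => he (by simpa only [G.rev_rev] using h'.2)
        rwa [G.rev_rev] at hrev
      · exact (h.rev fun h' => he h'.1).congr (hnext e).symm
  refine (hco.compl_subset hT hreg (fun e he => ?_) hx ⟨hx, isLinked_self T x⟩ hy).2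
  by_contra! hcon
  refine he ⟨fun h => ⟨hcon.2, h.2.rev fun h' => h.1 h'.1⟩, fun h => ⟨hcon.1, ?_⟩⟩
  have := h.2.rev fun h' => h.1 h'.1
  rwa [G.rev_rev] at this

end Separation

variable (G) in
/-- The chord formed by the first `n` edges of the strand of `d` is simple and cuts `T` into
`T ∩ X` and `T \ X`. -/
structure IsCut (T X : Set D) (d : D) (n : ℕ) : Prop extends G.IsChord T d n where
  isRegion_side : G.IsRegion X
  injOn_vertexOf : Set.InjOn (fun m => G.vertexOf ((G.straight ^ m) d)) (Set.Iic n)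
  border_inter_inner : G.border X ∩ G.inner T = G.arc d n

theorem IsChord.exists_isCut [Finite D] (hc : G.Connected) (hs : G.Spherical)
    (h : G.IsChord T d n) (hT : G.IsCoconnected T)
    (hinj : Set.InjOn (fun m => G.vertexOf ((G.straight ^ m) d)) (Set.Iic n)) :
    ∃ X, G.IsCut T X d n := by
  obtain ⟨z, hrev, hinner, hz⟩ := hT.isLinked h.isRegion h.rot_rot_notMem h.notMem
  obtain ⟨X, hX, -, hborder⟩ := hc.exists_isRegion_border_eq hs
    (z := fun a => G.arcChain d n a + z a) (fun a => by rw [arcChain_rev, hrev])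
    (fun a => by
      rw [boundary_add, boundary_arcChain, hz,
        vertexChain_congr (show G.vertexOf (G.rot (G.rot d)) = G.vertexOf d by
          simp only [vertexOf_rot])]
      exact CharTwo.add_self_eq_zero _) d
  refine ⟨X, h, hX, hinj, Set.ext fun e => ?_⟩
  have harc := arcChain_eq_one_iff (G := G) (d := d) (n := n)
    (fun m hm m' hm' heq => hinj hm.le hm'.le (congrArg G.vertexOf heq)) e
  rw [Set.mem_inter_iff, hborder]
  refine ⟨fun ⟨he, heT⟩ => ?_, fun he => ?_⟩
  · rwa [hinner e heT, add_zero, harc] at he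
  · have heT := arc_subset_inner h.mem_inner he
    exact ⟨by rw [hinner e heT, add_zero, harc.2 he], heT⟩

namespace IsCut

variable (h : G.IsCut T X d n)

include h

theorem compl : G.IsCut T Xᶜ d n where
  toIsChord := h.toIsChord
  isRegion_side := h.isRegion_side.compl
  injOn_vertexOf := h.injOn_vertexOf
  border_inter_inner := by rw [border_compl, h.border_inter_inner]

theorem mem_iff_rot_notMem (he : e ∈ G.arc d n) : e ∈ X ↔ G.rot e ∉ X := by
  rw [← h.border_inter_inner] at he
  have := h.isRegion_side.mem_border.1 he.1
  tauto

theorem mem_arc (he : e ∈ T) (he' : G.rot e ∈ T) (hX : ¬ (e ∈ X ↔ G.rot e ∈ X)) :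
    e ∈ G.arc d n := by
  rw [← h.border_inter_inner]
  exact ⟨h.isRegion_side.mem_border.2 hX, h.isRegion.mem_inner.2 ⟨he, he'⟩⟩

theorem isConvex_inter : G.IsConvex (T ∩ X) := by
  rintro e ⟨he, heX⟩ ⟨he2, he2X⟩
  have he1 := h.isConvex e he he2
  refine ⟨he1, by_contra fun he1X => ?_⟩
  exact rot_notMem_arc h.injOn_vertexOf
    (h.mem_arc he he1 fun hiff => he1X (hiff.1 heX))
    (h.mem_arc he1 he2 fun hiff => he1X (hiff.2 he2X))

theorem inter_subset_corners (he : e ∈ G.arc d n) (he2 : G.rot (G.rot e) ∉ T) :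
    {e, G.rot e} ∩ X ⊆ G.corners (T ∩ X) := by
  have heT := h.isRegion.mem_inner.1 (arc_subset_inner h.mem_inner he)
  have heX := h.mem_iff_rot_notMem he
  rintro _ ⟨rfl | rfl, hX⟩
  · exact ⟨⟨heT.1, hX⟩, fun h' => heX.1 hX h'.2, fun h' =>
      rot_three_notMem h.isConvex heT.2 he2 h'.1⟩
  · refine ⟨⟨heT.2, hX⟩, fun h' => he2 h'.1, fun h' => ?_⟩
    rw [G.rot_four] at h'
    exact heX.1 h'.2 hX

theorem corners_inter : G.corners (T ∩ X) = (G.corners T ∪ ({d, G.rot d} ∪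
    {G.arcEnd d n, G.rot (G.arcEnd d n)})) ∩ X := by
  refine Set.Subset.antisymm (fun e he => ⟨?_, he.1.2⟩) ?_
  · obtain ⟨⟨he0, heX⟩, he1, he3⟩ := he
    have harc1 (hT : G.rot e ∈ T) : e ∈ G.arc d n :=
      h.mem_arc he0 hT fun hiff => he1 ⟨hT, hiff.1 heX⟩
    have harc3 (hT : G.rot (G.rot (G.rot e)) ∈ T) : G.rot (G.rot (G.rot e)) ∈ G.arc d n :=
      h.mem_arc hT (by rwa [G.rot_four]) (by
        rw [G.rot_four]; exact fun hiff => he3 ⟨hT, hiff.2 heX⟩)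
    by_cases hT1 : G.rot e ∈ T
    · have hT3 : G.rot (G.rot (G.rot e)) ∉ T := fun hT3 =>
        rot_notMem_arc h.injOn_vertexOf (harc3 hT3) (by rw [G.rot_four]; exact harc1 hT1)
      have hT2 : G.rot (G.rot e) ∉ T := fun hT2 =>
        hT3 (h.isConvex _ hT2 (by rwa [G.rot_four]))
      exact Or.inr ((h.eq_or_eq_of_mem_arc (harc1 hT1) hT2).imp Or.inl Or.inl)
    · by_cases hT3 : G.rot (G.rot (G.rot e)) ∈ T
      · refine Or.inr ((h.eq_or_eq_of_mem_arc (harc3 hT3) (by rwa [G.rot_four])).imp ?_ ?_) <;>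
          exact fun heq => Or.inr (Set.mem_singleton_iff.2 (by rw [← heq, G.rot_four]))
      · exact Or.inl ⟨he0, hT1, hT3⟩
  · rintro e ⟨he | he | he, heX⟩
    · exact ⟨⟨he.1, heX⟩, fun h' => he.2.1 h'.1, fun h' => he.2.2 h'.1⟩
    · exact h.inter_subset_corners h.self_mem_arc h.rot_rot_notMem ⟨he, heX⟩
    · exact h.inter_subset_corners h.arcEnd_mem_arc (rot_rot_arcEnd ▸ h.notMem) ⟨he, heX⟩

theorem ncard_inter (he : e ∈ G.arc d n) : ({e, G.rot e} ∩ X : Set D).ncard = 1 := by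
  have heX := h.mem_iff_rot_notMem he
  by_cases hX : e ∈ X
  · rw [Set.insert_inter_of_mem hX, Set.singleton_inter_eq_empty.2 (heX.1 hX),
      insert_empty_eq]
    exact Set.ncard_singleton e
  · rw [Set.insert_inter_of_notMem hX,
      Set.inter_eq_left.2 (Set.singleton_subset_iff.2 (not_not.1 fun h' => hX (heX.2 h')))]
    exact Set.ncard_singleton _

theorem disjoint_corners (he : e ∈ G.arc d n) : Disjoint (G.corners T) {e, G.rot e} := by
  have heT := h.isRegion.mem_inner.1 (arc_subset_inner h.mem_inner he)
  refine Set.disjoint_right.2 ?_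
  rintro _ (rfl | rfl) hcorner
  · exact hcorner.2.1 heT.2
  · exact hcorner.2.2 (by rw [G.rot_four]; exact heT.1)

theorem disjoint_ends :
    Disjoint ({d, G.rot d} : Set D) {G.arcEnd d n, G.rot (G.arcEnd d n)} := by
  have hv : ∀ a ∈ ({d, G.rot d} : Set D), G.vertexOf a = G.vertexOf d := by
    rintro _ (rfl | rfl)
    · rfl
    · exact G.vertexOf_rot d
  refine Set.disjoint_left.2 fun a ha hb => h.vertexOf_end_ne ((hv a ha).symm.trans ?_)
  obtain rfl | rfl := hb <;> simp only [arcEnd, vertexOf_rot]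

theorem ncard_corners_inter [Finite D] :
    (G.corners (T ∩ X)).ncard = (G.corners T ∩ X).ncard + 2 := by
  have hmono {a b : Set D} (hab : Disjoint a b) : Disjoint (a ∩ X) (b ∩ X) :=
    hab.mono Set.inter_subset_left Set.inter_subset_left
  rw [h.corners_inter, Set.union_inter_distrib_right, Set.union_inter_distrib_right,
    Set.ncard_union_eq, Set.ncard_union_eq (hmono h.disjoint_ends), h.ncard_inter h.self_mem_arc,
    h.ncard_inter h.arcEnd_mem_arc]
  rw [← Set.union_inter_distrib_right]
  exact hmono (Set.disjoint_union_right.2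
    ⟨h.disjoint_corners h.self_mem_arc, h.disjoint_corners h.arcEnd_mem_arc⟩)

end IsCut

namespace IsMinimalLens

variable [Finite D] {o : D} {S : Set D} (hc : G.Connected) (hs : G.Spherical)
  (hS : G.IsMinimalLens o S) (hT : G.IsDisc o T) (hTS : T ⊆ S)

include hS hT hTS

include hc hs in
theorem exists_isCut (hd : d ∈ G.inner T) (hd2 : G.rot (G.rot d) ∉ T) (x : D) :
    ∃ X n, x ∈ X ∧ G.IsCut T X d n := by
  obtain ⟨n, h⟩ := exists_isChord hT.region hT.convex hd hd2
  have hinj := hS.injOn_vertexOf hc hs (d := d) (n := n) fun m hm =>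
    ⟨hTS (h.mem_inner m hm).1, hTS (h.mem_inner m hm).2⟩
  obtain ⟨X, hX⟩ := h.exists_isCut hc hs hT.coconnected (h.injOn hinj)
  by_cases hx : x ∈ X
  · exact ⟨X, n, hx, hX⟩
  · exact ⟨Xᶜ, n, hx, hX.compl⟩

theorem three_le_ncard_corners_fill_inter (h : G.IsCut T X d n) :
    3 ≤ (G.corners (G.fill o (T ∩ X))).ncard := by
  have hd := h.isRegion.mem_inner.1 h.self_mem_inner
  have hdX := h.mem_iff_rot_notMem h.self_mem_arc
  refine hS.three_le_ncard_corners_fill hT hTS Set.inter_subset_left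
    (h.isRegion.inter h.isRegion_side) h.isConvex_inter ?_ ?_
  · by_cases hX : d ∈ X
    · exact ⟨d, hd.1, hX⟩
    · exact ⟨G.rot d, hd.2, not_not.1 fun h' => hX (hdX.2 h')⟩
  · by_cases hX : d ∈ X
    · exact ⟨G.rot d, hd.2, by rw [h.isRegion.rev_mem]; exact h.rot_rot_notMem,
        fun h' => hdX.1 hX h'.2⟩
    · refine ⟨G.rev (G.rot (G.rot (G.rot d))), ?_, ?_, fun h' => hX ?_⟩
      · rw [h.isRegion.rev_mem, G.rot_four]
        exact hd.1
      · rw [G.rev_rev]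
        exact rot_three_notMem h.isConvex hd.2 h.rot_rot_notMem
      · have := h'.2
        rwa [h.isRegion_side.rev_mem, G.rot_four] at this

theorem corners_diff_nonempty (h : G.IsCut T X d n) : (G.corners T \ X).Nonempty := by
  have h3 := hS.three_le_ncard_corners_fill_inter hT hTS h.compl
  have hle := ncard_corners_fill_le (h.isRegion.inter h.isRegion_side.compl)
    (fun h' => hT.notMem h'.1) (o := o)
  have hcard := h.compl.ncard_corners_inter
  rw [← Set.ncard_pos, Set.sdiff_eq]
  omega

include hc hs in
theorem exists_triangle_disc {c : D} (hd : d ∈ G.inner T) (hd2 : G.rot (G.rot d) ∉ T)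
    (hcT : c ∈ G.corners T)
    (hcard : ∀ X, G.IsRegion X → c ∈ X → (G.corners T \ X).Nonempty →
      (G.corners T ∩ X).ncard ≤ 1) :
    ∃ F, G.IsDisc o F ∧ F ⊂ T ∧ (G.corners F).ncard = 3 ∧ c ∈ G.corners F ∧
      (G.next c = d → d ∈ G.corners F) ∧ (G.next (G.rot d) = c → G.rot d ∈ G.corners F) := by
  obtain ⟨X, n, hcX, h⟩ := exists_isCut hc hs hS hT hTS hd hd2 c
  have ho : o ∉ T ∩ X := fun h' => hT.notMem h'.1
  have hreg := h.isRegion.inter h.isRegion_side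
  have hle := hcard X h.isRegion_side hcX (hS.corners_diff_nonempty hT hTS h)
  have h3 := hS.three_le_ncard_corners_fill_inter hT hTS h
  have hnew := h.ncard_corners_inter
  have heq : G.corners (G.fill o (T ∩ X)) = G.corners (T ∩ X) :=
    Set.eq_of_subset_of_ncard_le (corners_fill_subset hreg ho) (by omega)
  have hd' := h.isRegion.mem_inner.1 h.self_mem_inner
  have hends := h.inter_subset_corners h.self_mem_arc h.rot_rot_notMem
  refine ⟨G.fill o (T ∩ X), isDisc_fill hreg h.isConvex_inter ⟨c, hcT.1, hcX⟩ ho,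
    (hT.fill_subset Set.inter_subset_left).ssubset_of_ne fun hfill => ?_, ?_⟩
  · obtain ⟨a, ha⟩ : ({d, G.rot d} ∩ X : Set D).Nonempty := by
      rw [← Set.ncard_pos, h.ncard_inter h.self_mem_arc]
      exact one_pos
    have haT : a ∈ G.corners T := by
      rw [← hfill, heq]
      exact hends ha
    exact Set.disjoint_left.1 (h.disjoint_corners h.self_mem_arc) haT ha.1
  rw [heq] at h3 ⊢
  refine ⟨by omega, by rw [h.corners_inter]; exact ⟨Or.inl hcT, hcX⟩, ?_, ?_⟩
  · rintro rfl
    exact hends ⟨Or.inl rfl, (h.isRegion_side c).2 hcX⟩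
  · rintro rfl
    exact hends ⟨Or.inr rfl, (h.isRegion_side _).1 hcX⟩

end IsMinimalLens

end Chords

/-! ### Triangles at the boundary of a minimal lens -/

section Triangles

variable {G : FourValentMap D} {o : D} {S T : Set D} {d e p : D}

theorem next_mem_inner (hT : G.IsRegion T) (he : e ∈ T) (he' : G.rev e ∉ T)
    (hcorner : G.next e ∉ G.corners T) : G.next e ∈ G.inner T := by
  have hnext := (hT e).2 he
  refine hT.mem_inner.2 ⟨hnext, by_contra fun h => hcorner ⟨hnext, h, ?_⟩⟩
  rwa [next_apply, G.rot_four]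

theorem rot_rot_next_notMem (hT : G.IsRegion T) (hconv : G.IsConvex T) (he : e ∈ T)
    (he' : G.rev e ∉ T) : G.rot (G.rot (G.next e)) ∉ T := fun h => by
  have h3 := hconv _ h (by rw [G.rot_four]; exact (hT e).2 he)
  rw [next_apply, G.rot_four] at h3
  exact he' h3

theorem rot_three_mem_inner (hT : G.IsRegion T) (he : e ∈ T) (he' : G.rev e ∉ T)
    (hcorner : e ∉ G.corners T) : G.rot (G.rot (G.rot e)) ∈ G.inner T := by
  rw [hT.mem_inner, G.rot_four]
  exact ⟨by_contra fun h => hcorner ⟨he, by rwa [← hT.rev_mem], h⟩, he⟩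

theorem rev_notMem_of_mem_corners (hT : G.IsRegion T) (he : e ∈ G.corners T) : G.rev e ∉ T := by
  rw [hT.rev_mem]
  exact he.2.1

theorem rev_notMem_of_next_mem_corners (he : G.next e ∈ G.corners T) : G.rev e ∉ T := by
  have := he.2.2
  rwa [next_apply, G.rot_four] at this

theorem vertexOf_ne_of_mem_corners (hconv : G.IsConvex T) (hd : d ∈ G.corners T)
    (he : e ∈ G.corners T) (hne : d ≠ e) : G.vertexOf d ≠ G.vertexOf e := by
  rw [Ne, vertexOf_eq_iff]
  rintro (rfl | rfl | rfl | rfl)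
  · exact hne rfl
  · exact hd.2.1 he.1
  · exact hd.2.1 (hconv _ hd.1 he.1)
  · exact hd.2.2 he.1

section Sides

variable [Finite D] (hT : G.IsRegion T) (hS : G.IsRegion S) (hconv : G.IsConvex S) (hTS : T ⊆ S)

include hT hS hconv hTS

theorem exists_next_mem_corners (he : e ∈ G.corners T) (he' : G.rev e ∉ S) :
    ∃ y ∈ T, G.rev y ∉ S ∧ G.next y ∈ G.corners T ∧ (y = e ∨ y ∉ G.corners T) := by
  by_contra! hcon
  set A : Set D := {y | y ∈ T ∧ G.rev y ∉ S ∧ (y = e ∨ y ∉ G.corners T)}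
  have hstep : ∀ y ∈ A, G.straight y ∈ T ∧ G.rev (G.straight y) ∉ S ∧
      G.straight y ∉ G.corners T := by
    rintro y ⟨hy, hy', hye⟩
    have hnext : G.next y ∉ G.corners T := fun h => by
      obtain ⟨hne, hc⟩ := hcon y hy hy' h
      exact hye.elim hne fun h => h hc
    refine ⟨(hT.mem_inner.1 (next_mem_inner hT hy (fun h => hy' (hTS h)) hnext)).2, ?_,
      fun h => h.2.2 ((hT.rot_three_straight_mem y).2 hy)⟩
    rw [hS.rev_mem]
    exact rot_rot_next_notMem hS hconv (hTS hy) hy'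
  have hsurj : Set.SurjOn G.straight A A := by
    refine (((Set.toFinite A).injOn_iff_bijOn_of_mapsTo fun y hy => ?_).1
      G.straight.injective.injOn).surjOn
    exact ⟨(hstep y hy).1, (hstep y hy).2.1, Or.inr (hstep y hy).2.2⟩
  obtain ⟨y, hy, rfl⟩ := hsurj ⟨he.1, he', Or.inl rfl⟩
  exact (hstep y hy).2.2 he

theorem exists_mem_corners (hp : G.next p ∈ G.corners T) (hp' : G.rev p ∉ S) :
    ∃ c ∈ G.corners T, G.rev c ∉ S ∧ (c = p ∨ G.straight c ∈ T) := by
  by_contra! hcon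
  set A : Set D := {y | y ∈ T ∧ G.rev y ∉ S ∧ (y = p ∨ G.straight y ∈ T)}
  have hstep : ∀ x, G.straight x ∈ A → x ∈ A := by
    rintro x ⟨hx, hx', hxp⟩
    have hrot : G.rot (G.straight x) ∉ T := fun h => hx' (hTS ((hT.rev_mem _).2 h))
    refine ⟨?_, fun h => hx' ?_, Or.inr hx⟩
    · rw [← hT.rot_three_straight_mem]
      by_contra h3
      have := hcon _ ⟨hx, hrot, h3⟩ hx'
      tauto
    · rw [hS.rev_mem]
      exact hconv _ (hTS hx) (by rwa [rot_rot_straight])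
  have hsurj : Set.SurjOn G.straight.symm A A := by
    refine (((Set.toFinite A).injOn_iff_bijOn_of_mapsTo fun y hy => hstep _ ?_).1
      G.straight.symm.injective.injOn).surjOn
    rwa [Equiv.apply_symm_apply]
  obtain ⟨y, hy, rfl⟩ := hsurj ⟨(hT p).1 hp.1, hp', Or.inl rfl⟩
  refine hp.2.1 ?_
  rw [next_apply, ← straight_apply, Equiv.apply_symm_apply]
  exact hy.1

end Sides

variable (G) in
/-- The face to the left of `t` has three edges and three different vertices. -/
structure IsTriangularFace (t : D) : Prop where
  next_next_next : G.next (G.next (G.next t)) = t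
  vertexOf_ne : G.vertexOf t ≠ G.vertexOf (G.next t)
  vertexOf_next_ne : G.vertexOf (G.next t) ≠ G.vertexOf (G.next (G.next t))
  vertexOf_next_next_ne : G.vertexOf (G.next (G.next t)) ≠ G.vertexOf t

theorem IsTriangularFace.next (h : G.IsTriangularFace d) : G.IsTriangularFace (G.next d) where
  next_next_next := by rw [h.next_next_next]
  vertexOf_ne := h.vertexOf_next_ne
  vertexOf_next_ne := by rw [h.next_next_next]; exact h.vertexOf_next_next_ne
  vertexOf_next_next_ne := by rw [h.next_next_next]; exact h.vertexOf_ne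

variable (G) in
/-- A disc in `S` with three corners, one of whose sides is the single edge of `next p`. -/
structure IsTriangularDisc (o : D) (S T : Set D) (p : D) : Prop extends G.IsDisc o T where
  subset : T ⊆ S
  ncard_corners : (G.corners T).ncard = 3
  next_mem : G.next p ∈ G.corners T
  next_next_mem : G.next (G.next p) ∈ G.corners T

theorem IsTriangularDisc.corners_eq [Finite D] (h : G.IsTriangularDisc o S T p) {c : D}
    (hloop : G.next (G.next p) ≠ G.next p) (hc : c ∈ G.corners T) (hne : c ≠ G.next p)
    (hne' : c ≠ G.next (G.next p)) :
    G.corners T = {G.next p, G.next (G.next p), c} := by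
  refine (Set.eq_of_subset_of_ncard_le ?_ ?_).symm
  · rintro x (rfl | rfl | rfl)
    exacts [h.next_mem, h.next_next_mem, hc]
  · rw [h.ncard_corners, Set.ncard_eq_three.2 ⟨_, _, _, hloop.symm, hne.symm, hne'.symm, rfl⟩]

theorem ncard_inter_le_one [Finite D] {A X : Set D} (hX : G.IsRegion X) {c : D}
    (hA : A = {d, G.next d, c}) (hc : c ∈ X) (hne : (A \ X).Nonempty) : (A ∩ X).ncard ≤ 1 := by
  subst hA
  have hd : d ∉ X := by
    intro hd
    obtain ⟨x, rfl | rfl | rfl, hx⟩ := hne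
    · exact hx hd
    · exact hx ((hX _).2 hd)
    · exact hx hc
  refine (Set.ncard_le_ncard (t := {c}) ?_).trans (Set.ncard_singleton c).le
  rintro x ⟨rfl | rfl | rfl, hx⟩
  · exact absurd hx hd
  · exact absurd ((hX _).1 hx) hd
  · rfl

namespace IsMinimalLens

variable [Finite D] (hc : G.Connected) (hs : G.Spherical) (hS : G.IsMinimalLens o S)

include hc hs hS

/-- Otherwise a chord would start at the end of `e` and cut off some of the corners, but all of
them lie on one face. -/
theorem next_mem_corners (hT : G.IsDisc o T) (hTS : T ⊆ S) (he : e ∈ G.corners T)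
    (hface : ∀ X, G.IsRegion X → e ∈ X → G.corners T ⊆ X) : G.next e ∈ G.corners T := by
  by_contra hn
  have he' := rev_notMem_of_mem_corners hT.region he
  obtain ⟨X, n, heX, h⟩ := exists_isCut hc hs hS hT hTS (next_mem_inner hT.region he.1 he' hn)
    (rot_rot_next_notMem hT.region hT.convex he.1 he') e
  obtain ⟨x, hx, hxX⟩ := hS.corners_diff_nonempty hT hTS h
  exact hxX (hface X h.isRegion_side heX hx)

theorem isTriangularFace_of_corners_eq (hT : G.IsDisc o T) (hTS : T ⊆ S)
    (hloop : ∀ d ∈ S, G.next d ≠ d) (h3 : (G.corners T).ncard = 3)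
    (hcorners : G.corners T = {d, G.next d, G.next (G.next d)}) : G.IsTriangularFace d := by
  have hd : d ∈ G.corners T := by simp [hcorners]
  have hd1 : G.next d ∈ G.corners T := by simp [hcorners]
  have hd2 : G.next (G.next d) ∈ G.corners T := by simp [hcorners]
  have hne : G.next (G.next d) ≠ d := fun h => by
    have := Set.ncard_insert_le (G.next d) {d}
    rw [hcorners, h, Set.insert_eq_of_mem (Set.mem_insert_of_mem _ (Set.mem_singleton d))] at h3
    rw [Set.ncard_singleton] at this
    omega
  have hnext : G.next (G.next (G.next d)) ∈ G.corners T :=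
    next_mem_corners hc hs hS hT hTS hd2 fun X hX h x hx => by
      rw [hX, hX] at h
      rw [hcorners] at hx
      obtain rfl | rfl | rfl := hx
      exacts [h, (hX _).2 h, (hX _).2 ((hX _).2 h)]
  refine ⟨?_, vertexOf_ne_of_mem_corners hT.convex hd hd1 (hloop d (hTS hd.1)).symm,
    vertexOf_ne_of_mem_corners hT.convex hd1 hd2 (hloop _ (hTS hd1.1)).symm,
    vertexOf_ne_of_mem_corners hT.convex hd2 hd hne⟩
  rw [hcorners] at hnext
  obtain h | h | h := hnext
  · exact h
  · exact absurd (G.next.injective h) hne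
  · exact absurd (G.next.injective h) (hloop _ (hTS hd1.1))

variable (hloop : ∀ d ∈ S, G.next d ≠ d)

include hloop

theorem exists_triangle_or_right (h : G.IsTriangularDisc o S T p) (hleft : G.rev p ∉ S)
    (hright : G.rev (G.next (G.next p)) ∈ S) :
    (∃ t ∈ S, G.rev t ∉ S ∧ G.IsTriangularFace t) ∨ ∃ F q, G.IsTriangularDisc o S F q ∧ F ⊂ T ∧
      G.rev q ∈ S ∧ G.rev (G.next (G.next q)) ∉ S := by
  obtain ⟨c, hcT, hcS, hcp⟩ :=
    exists_mem_corners h.region hS.region hS.convex h.subset h.next_mem hleft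
  have hloop' := hloop _ (h.subset h.next_mem.1)
  have hne : c ≠ G.next p := by
    rintro rfl
    obtain heq | hst := hcp
    · rw [heq] at hloop'
      exact hloop' heq
    · exact h.next_next_mem.2.1 hst
  have hne' : c ≠ G.next (G.next p) := fun heq => hcS (heq ▸ hright)
  have hcorners := h.corners_eq hloop' hcT hne hne'
  obtain ⟨i, rfl⟩ := G.next.surjective c
  have hiT : i ∈ T := (h.region i).1 hcT.1
  by_cases hi : i ∈ G.corners T
  · left
    have hi' : i = G.next (G.next p) := by
      rw [hcorners] at hi
      obtain heq | heq | heq := hi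
      · exact absurd (congrArg G.next heq) hne'
      · exact heq
      · exact absurd heq.symm (hloop _ (h.subset hiT))
    subst hi'
    exact ⟨_, h.subset hcT.1, hcS, (isTriangularFace_of_corners_eq hc hs hS h.toIsDisc h.subset
      hloop h.ncard_corners hcorners).next.next⟩
  · right
    have hri := rev_notMem_of_next_mem_corners hcT
    have hinner := rot_three_mem_inner h.region hiT hri hi
    obtain ⟨F, hF, hFT, hF3, hcF, -, hiF⟩ := exists_triangle_disc hc hs hS h.toIsDisc h.subset
      hinner (by rw [G.rot_four, ← h.region.rev_mem]; exact hri) hcT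
      fun X hX => ncard_inter_le_one hX hcorners
    rw [G.rot_four] at hiF
    have hq : G.next (G.rev (G.rot (G.rot (G.rot i)))) = i := by rw [next_rev, G.rot_four]
    exact ⟨F, G.rev (G.rot (G.rot (G.rot i))),
      ⟨hF, hFT.subset.trans h.subset, hF3, by rw [hq]; exact hiF rfl, by rwa [hq]⟩, hFT,
      by rw [G.rev_rev]; exact h.subset hinner.1, by rwa [hq]⟩

theorem exists_triangle_or_left (h : G.IsTriangularDisc o S T p) (hleft : G.rev p ∈ S)
    (hright : G.rev (G.next (G.next p)) ∉ S) :
    (∃ t ∈ S, G.rev t ∉ S ∧ G.IsTriangularFace t) ∨ ∃ F q, G.IsTriangularDisc o S F q ∧ F ⊂ T ∧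
      G.rev q ∉ S ∧ G.rev (G.next (G.next q)) ∈ S := by
  obtain ⟨y, hyT, hyS, hy, hyp⟩ :=
    exists_next_mem_corners h.region hS.region hS.convex h.subset h.next_next_mem hright
  have hloop' := hloop _ (h.subset h.next_mem.1)
  have hne : G.next y ≠ G.next p := fun heq => hyS (by rwa [G.next.injective heq])
  have hne' : G.next y ≠ G.next (G.next p) := fun heq => by
    obtain rfl := G.next.injective heq
    exact hyp.elim hloop'.symm fun hnot => hnot h.next_mem
  have hcorners := h.corners_eq hloop' hy hne hne'
  by_cases hn : G.next (G.next y) ∈ G.corners T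
  · left
    have hnext : G.next (G.next y) = G.next p := by
      rw [hcorners] at hn
      obtain heq | heq | heq := hn
      · exact heq
      · exact absurd (G.next.injective heq) hne
      · exact absurd heq (hloop _ (h.subset hy.1))
    have hface := isTriangularFace_of_corners_eq hc hs hS h.toIsDisc h.subset hloop
      h.ncard_corners (d := G.next y) (by
        rw [hnext, hcorners, Set.insert_comm, Set.pair_comm, Set.insert_comm, Set.pair_comm])
    refine ⟨_, h.subset h.next_next_mem.1, hright, ?_⟩
    rw [← hnext]
    exact hface.next.next
  · right
    have hry := rev_notMem_of_mem_corners h.region hy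
    have hinner := next_mem_inner h.region hy.1 hry hn
    obtain ⟨F, hF, hFT, hF3, hcF, hnF, -⟩ := exists_triangle_disc hc hs hS h.toIsDisc h.subset
      hinner (rot_rot_next_notMem h.region h.convex hy.1 hry) hy
      fun X hX => ncard_inter_le_one hX hcorners
    exact ⟨F, y, ⟨hF, hFT.subset.trans h.subset, hF3, hcF, hnF rfl⟩, hFT, hyS,
      h.subset hinner.2⟩

theorem exists_triangle_of_isTriangularDisc (h : G.IsTriangularDisc o S T p)
    (hside : ¬ (G.rev p ∈ S ↔ G.rev (G.next (G.next p)) ∈ S)) :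
    ∃ t ∈ S, G.rev t ∉ S ∧ G.IsTriangularFace t := by
  induction hn : T.ncard using Nat.strong_induction_on generalizing T p with
  | _ n ih =>
  subst hn
  by_cases hleft : G.rev p ∈ S
  · obtain ht | ⟨F, q, hF, hFT, hq, hq'⟩ :=
      exists_triangle_or_left hc hs hS hloop h hleft (by tauto)
    · exact ht
    · exact ih _ (Set.ncard_lt_ncard hFT) hF (by tauto) rfl
  · obtain ht | ⟨F, q, hF, hFT, hq, hq'⟩ :=
      exists_triangle_or_right hc hs hS hloop h hleft (by tauto)
    · exact ht
    · exact ih _ (Set.ncard_lt_ncard hFT) hF (by tauto) rfl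

omit hloop in
theorem corners_nonempty : (G.corners S).Nonempty := by
  obtain ⟨b, hb, hb'⟩ := hS.exists_mem_rev_notMem hc
  by_contra hempty
  have hb'' : b ∉ G.corners S := fun h => hempty ⟨b, h⟩
  obtain ⟨X, n, -, h⟩ := exists_isCut hc hs hS hS.toIsDisc subset_rfl
    (rot_three_mem_inner hS.region hb hb' hb'')
    (by rwa [G.rot_four, ← hS.region.rev_mem]) b
  exact hempty ((hS.corners_diff_nonempty hS.toIsDisc subset_rfl h).mono Set.sdiff_subset)

variable (hbigon : ∀ d ∈ S, G.next (G.next d) = d → G.vertexOf d = G.vertexOf (G.next d))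

include hbigon

theorem exists_next_notMem_corners : ∃ e ∈ G.corners S, G.next e ∉ G.corners S := by
  by_contra! hall
  obtain ⟨e, he⟩ := corners_nonempty hc hs hS
  have he1 := hall e he
  have he2 := hall _ he1
  have hne := (hloop e he.1).symm
  refine vertexOf_ne_of_mem_corners hS.convex he he1 hne (hbigon e he.1 (by_contra fun hne2 => ?_))
  have h3 := Set.ncard_eq_three.2
    ⟨e, G.next e, G.next (G.next e), hne, Ne.symm hne2, (hloop _ he1.1).symm, rfl⟩
  have hle : ({e, G.next e, G.next (G.next e)} : Set D).ncard ≤ (G.corners S).ncard :=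
    Set.ncard_le_ncard (by rintro x (rfl | rfl | rfl) <;> assumption)
  have := hS.ncard_corners_le
  omega

theorem exists_triangle : ∃ t ∈ S, G.rev t ∉ S ∧ G.IsTriangularFace t := by
  obtain ⟨e, he, hne⟩ := exists_next_notMem_corners hc hs hS hloop hbigon
  have he' := rev_notMem_of_mem_corners hS.region he
  have hinner := next_mem_inner hS.region he.1 he' hne
  obtain ⟨F, hF, hFT, hF3, heF, hnF, -⟩ := exists_triangle_disc hc hs hS hS.toIsDisc subset_rfl
    hinner (rot_rot_next_notMem hS.region hS.convex he.1 he') he fun X _ _ hdiff => by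
      have hsum := Set.ncard_inter_add_ncard_sdiff_eq_ncard (G.corners S) X
      have hpos := hdiff.ncard_pos
      have hle := hS.ncard_corners_le
      omega
  obtain ⟨p, rfl⟩ := G.next.surjective e
  exact exists_triangle_of_isTriangularDisc hc hs hS hloop ⟨hF, hFT.subset, hF3, heF, hnF rfl⟩
    fun hiff => rev_notMem_of_next_mem_corners he (hiff.2 hinner.2)

end IsMinimalLens

end Triangles

/-! ### Triangle moves -/

section Sides

variable (G : FourValentMap D)

/-- The sides of the triangle to the left of `d`, indexed cyclically. At the end of the side `i`
there are the darts `rev (side i)`, `side (i + 1)`, `rot (side (i + 1))` and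
`rot (rot (side (i + 1)))`, in this order with respect to `rot`. -/
def side (d : D) : Fin 3 → D := ![d, G.next d, G.next (G.next d)]

/-- The dart `x` does not issue from a corner of the triangle to the left of `d`. -/
def IsAwayFrom (d x : D) : Prop := ∀ i, G.vertexOf x ≠ G.vertexOf (G.side d i)

variable {G} {d x : D}

theorem IsAwayFrom.rot (hx : G.IsAwayFrom d x) : G.IsAwayFrom d (G.rot x) := fun i => by
  rw [vertexOf_rot]
  exact hx i

theorem IsAwayFrom.ne_side (hx : G.IsAwayFrom d x) (i : Fin 3) : x ≠ G.side d i := by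
  rintro rfl
  exact hx i rfl

theorem IsAwayFrom.ne_rot_side (hx : G.IsAwayFrom d x) (i : Fin 3) : x ≠ G.rot (G.side d i) := by
  rintro rfl
  exact hx i (vertexOf_rot _ _)

theorem IsAwayFrom.ne_rot_rot_side (hx : G.IsAwayFrom d x) (i : Fin 3) :
    x ≠ G.rot (G.rot (G.side d i)) := by
  rintro rfl
  exact hx i (by rw [vertexOf_rot, vertexOf_rot])

namespace IsTriangularFace

variable (h : G.IsTriangularFace d)

include h

theorem next_side (i : Fin 3) : G.next (G.side d i) = G.side d (i + 1) := by
  fin_cases i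
  exacts [rfl, rfl, h.next_next_next]

theorem eq_of_vertexOf_side_eq {i j : Fin 3}
    (hij : G.vertexOf (G.side d i) = G.vertexOf (G.side d j)) : i = j := by
  obtain ⟨-, h1, h2, h3⟩ := h
  fin_cases i <;> fin_cases j
  exacts [rfl, absurd hij h1, absurd hij.symm h3, absurd hij.symm h1, rfl, absurd hij h2,
    absurd hij h3, absurd hij.symm h2, rfl]

theorem side_injective : Function.Injective (G.side d) := fun _ _ hij =>
  h.eq_of_vertexOf_side_eq (congrArg _ hij)

theorem rot_three_side (i : Fin 3) :
    G.rot (G.rot (G.rot (G.side d (i + 1)))) = G.rev (G.side d i) := by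
  apply G.rot.injective
  rw [G.rot_four, ← next_apply, h.next_side]

theorem vertexOf_rev_side (i : Fin 3) :
    G.vertexOf (G.rev (G.side d i)) = G.vertexOf (G.side d (i + 1)) := by
  rw [← h.next_side, next_apply, vertexOf_rot]

theorem rot_side_ne_side (i j : Fin 3) : G.rot (G.side d i) ≠ G.side d j := fun hij => by
  obtain rfl := h.eq_of_vertexOf_side_eq (i := i) (j := j) (by rw [← hij, vertexOf_rot])
  exact G.rot_ne _ hij

theorem rot_rot_side_ne_side (i j : Fin 3) : G.rot (G.rot (G.side d i)) ≠ G.side d j :=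
  fun hij => by
    obtain rfl := h.eq_of_vertexOf_side_eq (i := i) (j := j)
      (by rw [← hij, vertexOf_rot, vertexOf_rot])
    exact G.rot_two_ne _ hij

theorem rot_rot_side_ne_rot_side (i j : Fin 3) :
    G.rot (G.rot (G.side d i)) ≠ G.rot (G.side d j) := fun hij =>
  h.rot_side_ne_side i j (G.rot.injective hij)

theorem rev_side_ne_side (i j : Fin 3) : G.rev (G.side d i) ≠ G.side d j := fun hij => by
  obtain rfl := h.eq_of_vertexOf_side_eq (i := i + 1) (j := j)
    (by rw [← hij, h.vertexOf_rev_side])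
  rw [← h.rot_three_side] at hij
  exact G.rot_three_ne _ hij

theorem rot_side_ne_rev_side (i j : Fin 3) : G.rot (G.side d i) ≠ G.rev (G.side d j) :=
  fun hij => h.rot_rot_side_ne_side (j + 1) i (G.rot.injective (by rw [h.rot_three_side, hij]))

theorem rot_rot_side_ne_rev_side (i j : Fin 3) :
    G.rot (G.rot (G.side d i)) ≠ G.rev (G.side d j) := fun hij =>
  h.rot_rot_side_ne_rot_side (j + 1) i (G.rot.injective (by rw [h.rot_three_side, hij]))

theorem ne_rev_side (hx : G.IsAwayFrom d x) (i : Fin 3) : x ≠ G.rev (G.side d i) := by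
  rintro rfl
  exact hx (i + 1) (h.vertexOf_rev_side i)

theorem dart_cases (x : D) : (∃ i, x = G.side d i) ∨ (∃ i, x = G.rot (G.side d (i + 1))) ∨
    (∃ i, x = G.rot (G.rot (G.side d (i + 1)))) ∨ (∃ i, x = G.rev (G.side d i)) ∨
    G.IsAwayFrom d x := by
  by_cases hx : G.IsAwayFrom d x
  · tauto
  simp only [IsAwayFrom, not_forall, not_not] at hx
  obtain ⟨i, hi⟩ := hx
  obtain ⟨j, rfl⟩ : ∃ j, i = j + 1 := ⟨i - 1, (sub_add_cancel i 1).symm⟩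
  obtain rfl | rfl | rfl | rfl := (G.vertexOf_eq_iff _ _).1 hi.symm
  exacts [Or.inl ⟨_, rfl⟩, Or.inr (Or.inl ⟨j, rfl⟩), Or.inr (Or.inr (Or.inl ⟨j, rfl⟩)),
    Or.inr (Or.inr (Or.inr (Or.inl ⟨j, h.rot_three_side j⟩)))]

theorem dart_rev_cases (x : D) : (∃ i, x = G.side d i) ∨ (∃ i, x = G.rev (G.side d i)) ∨
    (∀ i, x ≠ G.rev (G.side d i)) ∧
      ((∃ i, G.rev x = G.rot (G.side d (i + 1))) ∨
        (∃ i, G.rev x = G.rot (G.rot (G.side d (i + 1)))) ∨ G.IsAwayFrom d (G.rev x)) := by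
  by_cases hr : ∃ i, x = G.rev (G.side d i)
  · exact Or.inr (Or.inl hr)
  push Not at hr
  obtain ⟨i, hi⟩ | hi | hi | ⟨i, hi⟩ | hi := h.dart_cases (G.rev x)
  · exact absurd (by rw [← hi, G.rev_rev]) (hr i)
  · exact Or.inr (Or.inr ⟨hr, Or.inl hi⟩)
  · exact Or.inr (Or.inr ⟨hr, Or.inr (Or.inl hi)⟩)
  · exact Or.inl ⟨i, G.rev.injective hi⟩
  · exact Or.inr (Or.inr ⟨hr, Or.inr (Or.inr hi)⟩)

end IsTriangularFace

end Sides

section Faces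

variable {G : FourValentMap D} {d e : D} {X : Set D}

theorem apply_eq_of_faceOf_eq {β : Type*} {f : D → β} (hf : ∀ x, f (G.next x) = f x)
    (h : G.faceOf d = G.faceOf e) : f d = f e := by
  obtain ⟨i, rfl⟩ := (G.faceOf_eq_iff d e).1 h
  induction i using Int.induction_on with
  | zero => rfl
  | succ i ih =>
    rw [ih ((G.faceOf_eq_iff _ _).2 ⟨_, rfl⟩), add_comm, zpow_add, Equiv.Perm.mul_apply, zpow_one,
      hf]
  | pred i ih =>
    rw [ih ((G.faceOf_eq_iff _ _).2 ⟨_, rfl⟩), sub_eq_add_neg, add_comm, zpow_add,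
      Equiv.Perm.mul_apply, zpow_neg_one,
      ← hf (G.next⁻¹ _), Equiv.Perm.coe_inv, Equiv.apply_symm_apply]

theorem IsRegion.mem_iff_of_faceOf_eq (hX : G.IsRegion X) (h : G.faceOf d = G.faceOf e) :
    d ∈ X ↔ e ∈ X :=
  iff_of_eq (apply_eq_of_faceOf_eq (f := (· ∈ X)) (fun x => propext (hX x)) h)

end Faces

/-- The map `H` arises from `G` by a triangle move at the triangle to the left of `d`. The move is
given by the successors under `H.rot` of the sides, the legs and the reversed sides. That the two
rotations are conjugate implies that `H` has as many vertices as `G`. -/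
structure IsMove (G H : FourValentMap D) (d : D) : Prop extends G.IsTriangularFace d where
  rev_eq : H.rev = G.rev
  exists_rot_eq_conj : ∃ s : Equiv.Perm D, H.rot = s * G.rot * s⁻¹
  rot_side : ∀ i, H.rot (G.side d i) = G.rot (G.rot (G.side d (i + 1)))
  rot_rot_rot_side : ∀ i, H.rot (G.rot (G.rot (G.side d (i + 1)))) = G.rot (G.side d i)
  rot_rot_side : ∀ i, H.rot (G.rot (G.side d (i + 1))) = G.rev (G.side d i)
  rot_rev_side : ∀ i, H.rot (G.rev (G.side d i)) = G.side d (i + 1)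
  rot_eq : ∀ x, G.IsAwayFrom d x → H.rot x = G.rot x

section FaceCorrespondence

variable (G : FourValentMap D)

/-- The map of darts that sends the reversed side `i` of a triangle to `v i` and fixes all other
darts. -/
noncomputable def redirect (d : D) (v : Fin 3 → D) : D → D :=
  Function.extend (fun i => G.rev (G.side d i)) v id

/-- A triangle move does not affect the faces to the left of darts other than the reversed sides of
the triangle. If `H` arises from `G` by a move at `d`, then the face of `H` to the left of `x`
corresponds to the face of `G` to the left of `G.toOld d x`. -/
noncomputable def toOld (d : D) : D → D :=
  G.redirect d fun i => G.rot (G.rot (G.side d (i + 1)))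

/-- The correspondence of faces inverse to `toOld`: the face of `G` to the left of `x` corresponds
to the face of `H` to the left of `G.toNew d x`. -/
noncomputable def toNew (d : D) : D → D := G.redirect d fun i => G.rot (G.side d i)

variable {G} {H : FourValentMap D} {d x y : D}

theorem redirect_of_ne {v : Fin 3 → D} (hx : ∀ i, x ≠ G.rev (G.side d i)) :
    G.redirect d v x = x :=
  Function.extend_apply' _ _ _ fun ⟨i, hi⟩ => hx i hi.symm

theorem IsTriangularFace.redirect_rev_side (h : G.IsTriangularFace d) (v : Fin 3 → D) (i : Fin 3) :
    G.redirect d v (G.rev (G.side d i)) = v i :=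
  (G.rev.injective.comp h.side_injective).extend_apply v id i

theorem faceOf_rot_side (i : Fin 3) :
    G.faceOf (G.rot (G.side d i)) = G.faceOf (G.rev (G.side d i)) :=
  (G.faceOf_rev _).symm

namespace IsMove

variable (h : G.IsMove H d)

include h

theorem next_side_right (i : Fin 3) : H.next (G.side d i) = G.side d (i + 1) := by
  rw [next_apply, h.rev_eq, h.rot_rev_side]

theorem next_rev_side (i : Fin 3) :
    H.next (G.rev (G.side d i)) = G.rot (G.rot (G.side d (i + 1))) := by
  rw [← h.rev_eq, next_rev, h.rot_side]

theorem toOld_rev_side (i : Fin 3) :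
    G.toOld d (G.rev (G.side d i)) = G.rot (G.rot (G.side d (i + 1))) :=
  h.redirect_rev_side _ i

theorem toNew_rev_side (i : Fin 3) : G.toNew d (G.rev (G.side d i)) = G.rot (G.side d i) :=
  h.redirect_rev_side _ i

theorem faceOf_toOld_next (x : D) :
    G.faceOf (G.toOld d (H.next x)) = G.faceOf (G.toOld d x) := by
  obtain ⟨i, rfl⟩ | ⟨i, rfl⟩ | ⟨hx, ⟨i, hi⟩ | ⟨i, hi⟩ | hi⟩ := h.dart_rev_cases x
  · rw [h.next_side_right, toOld, redirect_of_ne fun j => (h.rev_side_ne_side j _).symm,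
      redirect_of_ne fun j => (h.rev_side_ne_side j _).symm, ← h.next_side, faceOf_next]
  · rw [h.next_rev_side, h.toOld_rev_side, toOld,
      redirect_of_ne fun j => h.rot_rot_side_ne_rev_side _ j]
  · rw [next_apply, h.rev_eq, hi, h.rot_rot_side, h.toOld_rev_side, toOld, redirect_of_ne hx,
      ← faceOf_next _ x, next_apply, hi]
  · rw [next_apply, h.rev_eq, hi, h.rot_rot_rot_side, toOld,
      redirect_of_ne fun j => h.rot_side_ne_rev_side _ j, redirect_of_ne hx, ← faceOf_next _ x,
      next_apply, hi, h.rot_three_side, faceOf_rot_side]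
  · rw [next_apply, h.rev_eq, h.rot_eq _ hi, toOld, redirect_of_ne (h.ne_rev_side hi.rot),
      redirect_of_ne hx, ← next_apply, faceOf_next]

theorem faceOf_toNew_next (x : D) :
    H.faceOf (G.toNew d (G.next x)) = H.faceOf (G.toNew d x) := by
  obtain ⟨i, rfl⟩ | ⟨i, rfl⟩ | ⟨hx, ⟨i, hi⟩ | ⟨i, hi⟩ | hi⟩ := h.dart_rev_cases x
  · rw [h.next_side, toNew, redirect_of_ne fun j => (h.rev_side_ne_side j _).symm,
      redirect_of_ne fun j => (h.rev_side_ne_side j _).symm, ← h.next_side_right, faceOf_next]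
  · rw [next_rev, h.toNew_rev_side, toNew, redirect_of_ne fun j => h.rot_side_ne_rev_side _ j]
  · rw [next_apply, hi, toNew, redirect_of_ne fun j => h.rot_rot_side_ne_rev_side _ j,
      redirect_of_ne hx, ← faceOf_next _ x, next_apply, h.rev_eq, hi, h.rot_rot_side,
      ← h.next_rev_side, faceOf_next]
  · rw [next_apply, hi, h.rot_three_side, h.toNew_rev_side, toNew, redirect_of_ne hx,
      ← faceOf_next _ x, next_apply, h.rev_eq, hi, h.rot_rot_rot_side]
  · rw [next_apply, toNew, redirect_of_ne (h.ne_rev_side hi.rot), redirect_of_ne hx,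
      ← faceOf_next _ x, next_apply, h.rev_eq, h.rot_eq _ hi]

theorem faceOf_toOld_toNew (x : D) : G.faceOf (G.toOld d (G.toNew d x)) = G.faceOf x := by
  by_cases hx : ∃ i, x = G.rev (G.side d i)
  · obtain ⟨i, rfl⟩ := hx
    rw [h.toNew_rev_side, toOld, redirect_of_ne fun j => h.rot_side_ne_rev_side _ j,
      faceOf_rot_side]
  · push Not at hx
    rw [toNew, redirect_of_ne hx, toOld, redirect_of_ne hx]

theorem faceOf_toNew_toOld (x : D) : H.faceOf (G.toNew d (G.toOld d x)) = H.faceOf x := by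
  by_cases hx : ∃ i, x = G.rev (G.side d i)
  · obtain ⟨i, rfl⟩ := hx
    rw [h.toOld_rev_side, toNew, redirect_of_ne fun j => h.rot_rot_side_ne_rev_side _ j,
      ← h.next_rev_side, faceOf_next]
  · push Not at hx
    rw [toOld, redirect_of_ne hx, toNew, redirect_of_ne hx]

theorem faceOf_toOld_eq (hxy : H.faceOf x = H.faceOf y) :
    G.faceOf (G.toOld d x) = G.faceOf (G.toOld d y) :=
  apply_eq_of_faceOf_eq (f := fun x => G.faceOf (G.toOld d x)) h.faceOf_toOld_next hxy

theorem faceOf_toNew_eq (hxy : G.faceOf x = G.faceOf y) :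
    H.faceOf (G.toNew d x) = H.faceOf (G.toNew d y) :=
  apply_eq_of_faceOf_eq (f := fun x => H.faceOf (G.toNew d x)) h.faceOf_toNew_next hxy

theorem card_face : Nat.card H.Face = Nat.card G.Face :=
  Nat.card_congr
    { toFun := Quotient.lift (fun x => G.faceOf (G.toOld d x)) fun x y hxy =>
        h.faceOf_toOld_eq ((H.faceOf_eq_iff x y).2 hxy)
      invFun := Quotient.lift (fun x => H.faceOf (G.toNew d x)) fun x y hxy =>
        h.faceOf_toNew_eq ((G.faceOf_eq_iff x y).2 hxy)
      left_inv := Quotient.ind h.faceOf_toNew_toOld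
      right_inv := Quotient.ind h.faceOf_toOld_toNew }

theorem faceOf_eq_iff (hx : ∀ i, x ≠ G.rev (G.side d i)) (hy : ∀ i, y ≠ G.rev (G.side d i)) :
    H.faceOf x = H.faceOf y ↔ G.faceOf x = G.faceOf y := by
  constructor <;> intro hxy
  · have := h.faceOf_toOld_eq hxy
    rwa [toOld, redirect_of_ne hx, redirect_of_ne hy] at this
  · have := h.faceOf_toNew_eq hxy
    rwa [toNew, redirect_of_ne hx, redirect_of_ne hy] at this

theorem isRegion_preimage_toOld {X : Set D} (hX : G.IsRegion X) :
    H.IsRegion (G.toOld d ⁻¹' X) := fun x =>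
  hX.mem_iff_of_faceOf_eq (h.faceOf_toOld_next x)

theorem isRegion_preimage_toNew {X : Set D} (hX : H.IsRegion X) :
    G.IsRegion (G.toNew d ⁻¹' X) := fun x =>
  hX.mem_iff_of_faceOf_eq (h.faceOf_toNew_next x)

theorem spherical (hs : G.Spherical) : H.Spherical := by
  have hV : Nat.card H.Vertex = Nat.card G.Vertex := by
    obtain ⟨s, hs⟩ := h.exists_rot_eq_conj
    refine Nat.card_congr (Quotient.congr s⁻¹ fun a b => ?_)
    change H.rot.SameCycle a b ↔ G.rot.SameCycle (s⁻¹ a) (s⁻¹ b)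
    rw [hs, Equiv.Perm.sameCycle_conj]
  have hE : Nat.card H.Edge = Nat.card G.Edge := by
    unfold Edge
    rw [h.rev_eq]
  rw [Spherical, hV, hE, h.card_face]
  exact hs

theorem mapsTo_rot {A : Set D} (hrot : Set.MapsTo H.rot A A) (hrev : Set.MapsTo G.rev A A) :
    Set.MapsTo G.rot A A := by
  have hsucc : ∀ {i}, G.side d i ∈ A → G.side d (i + 1) ∈ A := fun {i} hi =>
    h.rot_rev_side i ▸ hrot (hrev hi)
  have hside : ∀ {i}, G.side d i ∈ A → ∀ j, G.side d j ∈ A := fun {i} hi j => by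
    obtain rfl | rfl | rfl := eq_or_eq_add_one_of_fin_three i j
    exacts [hi, hsucc hi, hsucc (hsucc hi)]
  have hu : ∀ {i}, G.rot (G.side d (i + 1)) ∈ A → G.side d (i + 1) ∈ A := fun {i} hi =>
    h.rot_rev_side i ▸ hrot (h.rot_rot_side i ▸ hrot hi)
  have hw : ∀ {i}, G.side d i ∈ A → G.rot (G.rot (G.side d (i + 1))) ∈ A := fun {i} hi =>
    h.rot_side i ▸ hrot hi
  intro x hx
  obtain ⟨i, rfl⟩ | ⟨i, rfl⟩ | ⟨i, rfl⟩ | ⟨i, rfl⟩ | hx' := h.dart_cases x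
  · rw [← h.rot_rot_rot_side]
    exact hrot (hw hx)
  · exact hw (hside (hu hx) i)
  · obtain ⟨j, rfl⟩ : ∃ j, i = j + 1 := ⟨i - 1, (sub_add_cancel i 1).symm⟩
    rw [h.rot_three_side]
    exact hrev (hu (h.rot_rot_rot_side _ ▸ hrot hx))
  · rw [← next_apply, h.next_side, ← h.rot_rev_side]
    exact hrot hx
  · rw [← h.rot_eq x hx']
    exact hrot hx

theorem connected [Finite D] (hc : G.Connected) : H.Connected :=
  connected_iff.2 fun _ hrot hrev hne => by
    rw [h.rev_eq] at hrev
    exact connected_iff.1 hc _ (h.mapsTo_rot hrot hrev) hrev hne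

theorem next_eq_or_next_next_eq (hx : H.next x = x) : (∀ i, x ≠ G.rev (G.side d i)) ∧
    (G.next x = x ∨ G.next (G.next x) = x ∧ G.vertexOf x ≠ G.vertexOf (G.next x)) := by
  have hne : ∀ i : Fin 3, i + 1 ≠ i := by decide
  obtain ⟨i, rfl⟩ | ⟨i, rfl⟩ | ⟨hr, ⟨i, hi⟩ | ⟨i, hi⟩ | hi⟩ := h.dart_rev_cases x
  · rw [h.next_side_right] at hx
    exact absurd (h.side_injective hx) (hne i)
  · rw [h.next_rev_side] at hx
    exact absurd hx (h.rot_rot_side_ne_rev_side _ _)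
  · rw [next_apply, h.rev_eq, hi, h.rot_rot_side] at hx
    exact absurd hx.symm (hr i)
  · rw [next_apply, h.rev_eq, hi, h.rot_rot_rot_side] at hx
    have hnext : G.next x = G.rev (G.side d i) := by rw [next_apply, hi, h.rot_three_side]
    refine ⟨hr, Or.inr ⟨by rw [hnext, next_rev, hx], ?_⟩⟩
    rw [hnext, h.vertexOf_rev_side, ← hx, vertexOf_rot]
    exact fun hv => hne i (h.eq_of_vertexOf_side_eq hv.symm)
  · rw [next_apply, h.rev_eq, h.rot_eq _ hi] at hx
    exact ⟨hr, Or.inl hx⟩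

end IsMove

end FaceCorrespondence

section Shrink

/-- What remains of the region `S` when the triangle to the left of `d` is moved out of it. -/
def shrink (G : FourValentMap D) (d : D) (S : Set D) : Set D :=
  G.toOld d ⁻¹' S \ Set.range (G.side d)

variable {G H : FourValentMap D} {d o x : D} {S : Set D}

theorem IsRegion.side_mem (hS : G.IsRegion S) (hd : d ∈ S) (i : Fin 3) : G.side d i ∈ S := by
  fin_cases i
  exacts [hd, (hS _).2 hd, (hS _).2 ((hS _).2 hd)]

theorem IsConvex.rot_side_mem (hconv : G.IsConvex S) (hS : G.IsRegion S) (hd : d ∈ S) {i : Fin 3}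
    (hi : G.rot (G.rot (G.side d i)) ∈ S) : G.rot (G.side d i) ∈ S :=
  hconv _ (hS.side_mem hd i) hi

theorem side_notMem_shrink (i : Fin 3) : G.side d i ∉ G.shrink d S := fun h => h.2 ⟨i, rfl⟩

theorem mem_shrink (hr : ∀ i, x ≠ G.rev (G.side d i)) (hs : ∀ i, x ≠ G.side d i) :
    x ∈ G.shrink d S ↔ x ∈ S := by
  refine (and_iff_left fun ⟨i, hi⟩ => hs i hi.symm).trans ?_
  rw [Set.mem_preimage, toOld, redirect_of_ne hr]

theorem IsTriangularFace.mem_shrink (h : G.IsTriangularFace d) (hx : G.IsAwayFrom d x) :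
    x ∈ G.shrink d S ↔ x ∈ S :=
  FourValentMap.mem_shrink (h.ne_rev_side hx) hx.ne_side

theorem IsTriangularFace.rot_side_mem_shrink (h : G.IsTriangularFace d) (i : Fin 3) :
    G.rot (G.side d i) ∈ G.shrink d S ↔ G.rot (G.side d i) ∈ S :=
  FourValentMap.mem_shrink (h.rot_side_ne_rev_side i) (h.rot_side_ne_side i)

theorem IsTriangularFace.rot_rot_side_mem_shrink (h : G.IsTriangularFace d) (i : Fin 3) :
    G.rot (G.rot (G.side d i)) ∈ G.shrink d S ↔ G.rot (G.rot (G.side d i)) ∈ S :=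
  FourValentMap.mem_shrink (h.rot_rot_side_ne_rev_side i) (h.rot_rot_side_ne_side i)

namespace IsMove

variable (h : G.IsMove H d)

include h

theorem rev_side_mem_shrink (i : Fin 3) :
    G.rev (G.side d i) ∈ G.shrink d S ↔ G.rot (G.rot (G.side d (i + 1))) ∈ S := by
  refine (and_iff_left fun ⟨j, hj⟩ => h.rev_side_ne_side i j hj.symm).trans ?_
  rw [Set.mem_preimage, h.toOld_rev_side]

theorem isRegion_shrink (hS : G.IsRegion S) : H.IsRegion (G.shrink d S) := by
  refine fun x => and_congr (h.isRegion_preimage_toOld hS x) (not_congr ⟨?_, ?_⟩)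
  · rintro ⟨i, hi⟩
    refine ⟨i - 1, H.next.injective ?_⟩
    rw [h.next_side_right, sub_add_cancel, hi]
  · rintro ⟨i, rfl⟩
    exact ⟨i + 1, (h.next_side_right i).symm⟩

variable (hS : G.IsRegion S) (hconv : G.IsConvex S) (hd : d ∈ S)

include hS hd in
theorem nonempty_shrink [Finite D] (hcard : (G.corners S).ncard ≤ 2) :
    (G.shrink d S).Nonempty := by
  by_contra hne
  have hrot : ∀ i, G.rot (G.side d i) ∉ S := fun i hi => hne ⟨_, (h.rot_side_mem_shrink i).2 hi⟩
  have hcorner : Set.range (G.side d) ⊆ G.corners S := by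
    rintro _ ⟨i, rfl⟩
    obtain ⟨j, rfl⟩ : ∃ j, i = j + 1 := ⟨i - 1, (sub_add_cancel i 1).symm⟩
    refine ⟨hS.side_mem hd _, hrot _, ?_⟩
    rw [h.rot_three_side, hS.rev_mem]
    exact hrot j
  have hle := Set.ncard_le_ncard hcorner
  rw [← Set.image_univ, Set.ncard_image_of_injective _ h.side_injective, Set.ncard_univ,
    Nat.card_fin] at hle
  omega

include hS hconv hd

theorem rev_side_mem {i : Fin 3}
    (hi : G.rot (G.rot (G.side d (i + 1))) ∈ S) : G.rev (G.side d i) ∈ S := by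
  rw [← h.rot_three_side]
  refine hconv _ hi ?_
  rw [G.rot_four]
  exact hS.side_mem hd _

theorem isConvex_shrink (hrev : G.rev d ∉ S) : H.IsConvex (G.shrink d S) := by
  intro x hx hx2
  obtain ⟨i, rfl⟩ | ⟨i, rfl⟩ | ⟨i, rfl⟩ | ⟨i, rfl⟩ | haway := h.dart_cases x
  · exact absurd hx (side_notMem_shrink i)
  · rw [h.rot_rot_side, h.rot_rev_side] at hx2
    exact absurd hx2 (side_notMem_shrink _)
  · rw [h.rot_rot_side_mem_shrink] at hx
    rw [h.rot_rot_rot_side, h.rot_side_mem_shrink, ← hS.rev_mem]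
    exact h.rev_side_mem hS hconv hd hx
  · rw [h.rev_side_mem_shrink] at hx
    rw [h.rot_rev_side, h.rot_side, h.rot_rot_side_mem_shrink] at hx2
    have h0 := h.rev_side_mem hS hconv hd hx
    have h1 := hconv.rot_side_mem hS hd hx
    have h2 := hconv.rot_side_mem hS hd hx2
    rw [← hS.rev_mem] at h1 h2
    have hk : G.rev (G.side d 0) ∉ S := hrev
    obtain hi | hi | hi := eq_or_eq_add_one_of_fin_three i 0 <;> rw [hi] at hk <;> contradiction
  · rw [h.mem_shrink haway] at hx
    rw [h.rot_eq _ haway, h.rot_eq _ haway.rot, h.mem_shrink haway.rot.rot] at hx2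
    rw [h.rot_eq _ haway, h.mem_shrink haway.rot]
    exact hconv _ hx hx2

theorem side_mem_corners {i : Fin 3} (hi : G.rot (G.side d (i + 1)) ∈ H.corners (G.shrink d S)) :
    G.side d i ∈ G.corners S := by
  obtain ⟨h0, h1, h3⟩ := hi
  rw [h.rot_side_mem_shrink] at h0
  rw [h.rot_rot_side, h.rev_side_mem_shrink] at h1
  rw [h.rot_rot_side, h.rot_rev_side, h.rot_side, h.rot_rot_side_mem_shrink] at h3
  have hopp : ∀ {j}, G.rot (G.side d (j + 1)) ∈ S → G.rev (G.side d j) ∈ S →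
      G.rot (G.rot (G.side d (j + 1))) ∈ S := fun {j} hu hr =>
    hconv _ hu (by rwa [h.rot_three_side])
  refine ⟨hS.side_mem hd i, fun hu => h1 (hopp h0 ((hS.rev_mem _).2 hu)), fun hr => h3 ?_⟩
  have hi : i = i + 1 + 1 + 1 := by clear * -; decide +revert
  rw [hi, h.rot_three_side, hS.rev_mem] at hr
  exact hopp hr ((hS.rev_mem _).2 h0)

theorem corners_shrink_subset : H.corners (G.shrink d S) ⊆
    Function.extend (G.side d) (fun i => G.rot (G.side d (i + 1))) id '' G.corners S := by
  rintro x hx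
  obtain ⟨i, rfl⟩ | ⟨i, rfl⟩ | ⟨i, rfl⟩ | ⟨i, rfl⟩ | haway := h.dart_cases x
  · exact absurd hx.1 (side_notMem_shrink i)
  · exact ⟨_, h.side_mem_corners hS hconv hd hx, h.side_injective.extend_apply _ _ i⟩
  · obtain ⟨h0, h1, -⟩ := hx
    rw [h.rot_rot_side_mem_shrink] at h0
    rw [h.rot_rot_rot_side, h.rot_side_mem_shrink, ← hS.rev_mem] at h1
    exact absurd (h.rev_side_mem hS hconv hd h0) h1
  · obtain ⟨h0, -, h3⟩ := hx
    rw [h.rev_side_mem_shrink] at h0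
    rw [h.rot_rev_side, h.rot_side, h.rot_rot_rot_side, h.rot_side_mem_shrink] at h3
    exact absurd (hconv.rot_side_mem hS hd h0) h3
  · obtain ⟨h0, h1, h3⟩ := hx
    rw [h.mem_shrink haway] at h0
    rw [h.rot_eq _ haway, h.mem_shrink haway.rot] at h1
    rw [h.rot_eq _ haway, h.rot_eq _ haway.rot, h.rot_eq _ haway.rot.rot,
      h.mem_shrink haway.rot.rot.rot] at h3
    exact ⟨x, ⟨h0, h1, h3⟩, Function.extend_apply' _ _ _ fun ⟨i, hi⟩ => haway.ne_side i hi.symm⟩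

theorem ncard_corners_shrink_le [Finite D] :
    (H.corners (G.shrink d S)).ncard ≤ (G.corners S).ncard :=
  (Set.ncard_le_ncard (h.corners_shrink_subset hS hconv hd)).trans
    (Set.ncard_image_le (Set.toFinite _))

theorem shrink_subset : G.shrink d S ⊆ S := by
  intro x hx
  by_cases hr : ∃ i, x = G.rev (G.side d i)
  · obtain ⟨i, rfl⟩ := hr
    exact h.rev_side_mem hS hconv hd ((h.rev_side_mem_shrink i).1 hx)
  · push Not at hr
    exact (FourValentMap.mem_shrink hr fun i hi => side_notMem_shrink i (hi ▸ hx)).1 hx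

variable (hco : G.IsCoconnected S) (hrev : G.rev d ∉ S) (ho : o ∉ S)
  (hor : ∀ i, o ≠ G.rev (G.side d i))

include hco ho hor

theorem compl_subset_component_shrink : Sᶜ ⊆ H.component (H.border (G.shrink d S)) o := by
  set C := H.component (H.border (G.shrink d S)) o
  have hC : H.IsRegion C := isRegion_component _ _
  have hsub := h.shrink_subset hS hconv hd
  have hpre : Sᶜ ⊆ G.toNew d ⁻¹' C := by
    refine hco.compl_subset hS (h.isRegion_preimage_toNew hC) (fun x hx => ?_) ho ?_
    · by_contra! hxS
      have hne : ∀ i, x ≠ G.rev (G.side d i) := by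
        rintro i rfl
        exact hxS.2 (by rw [G.rev_rev]; exact hS.side_mem hd i)
      have hne' : ∀ i, G.rev x ≠ G.rev (G.side d i) := fun i hi =>
        hxS.1 (G.rev.injective hi ▸ hS.side_mem hd i)
      refine hx ?_
      rw [Set.mem_preimage, Set.mem_preimage, toNew, redirect_of_ne hne, redirect_of_ne hne',
        ← h.rev_eq, rev_mem_component_iff]
      exact notMem_border (fun hm => hxS.1 (hsub hm)) fun hm => hxS.2 (h.rev_eq ▸ hsub hm)
    · rw [Set.mem_preimage, toNew, redirect_of_ne hor]
      exact self_mem_component _ _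
  intro x hx
  by_cases hr : ∃ i, x = G.rev (G.side d i)
  · obtain ⟨i, rfl⟩ := hr
    have hw := hpre fun hw => hx (h.rev_side_mem hS hconv hd (i := i) hw)
    rwa [Set.mem_preimage, toNew, redirect_of_ne (h.rot_rot_side_ne_rev_side _),
      ← h.next_rev_side, hC] at hw
  · push Not at hr
    have := hpre hx
    rwa [Set.mem_preimage, toNew, redirect_of_ne hr] at this

include hrev in
theorem fill_shrink_ssubset : H.fill o (G.shrink d S) ⊂ S := by
  have hcompl := h.compl_subset_component_shrink hS hconv hd hco ho hor
  refine (Set.compl_subset_comm.1 hcompl).ssubset_of_mem_notMem hd fun hdC => hdC ?_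
  have hborder : d ∉ H.border (G.shrink d S) := notMem_border (side_notMem_shrink 0) fun hm =>
    hrev (h.shrink_subset hS hconv hd (h.rev_eq ▸ hm))
  rw [← rev_mem_component_iff hborder, h.rev_eq]
  exact hcompl hrev

end IsMove

end Shrink

end FourValentMap

namespace PlaneFourValentGraph

open FourValentMap

variable {D : Type*} {G : PlaneFourValentGraph D} {d : D}

theorem IsTriangle.isTriangularFace (h : G.IsTriangle d) : G.IsTriangularFace d :=
  ⟨h.1, h.2.1, h.2.2.1, h.2.2.2.1⟩

theorem IsTriangle.nodup_legs (h : G.IsTriangle d) : (G.legs d).Nodup := by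
  have huu : ∀ i j, i ≠ j → G.rot (G.side d i) ≠ G.rot (G.side d j) := fun i j hij heq =>
    hij (h.isTriangularFace.side_injective (G.rot.injective heq))
  have hww : ∀ i j, i ≠ j → G.rot (G.rot (G.side d i)) ≠ G.rot (G.rot (G.side d j)) :=
    fun i j hij heq => huu i j hij (G.rot.injective heq)
  have hwu := h.isTriangularFace.rot_rot_side_ne_rot_side
  change [G.rot (G.rot (G.side d 0)), G.rot (G.side d 0), G.rot (G.rot (G.side d 1)),
    G.rot (G.side d 1), G.rot (G.rot (G.side d 2)), G.rot (G.side d 2)].Nodup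
  simp [huu, hww, hwu, fun i j => (hwu i j).symm]

section Shift

variable [DecidableEq D]

theorem IsTriangle.shift_rot_rot_side (h : G.IsTriangle d) (i : Fin 3) :
    G.shift d (G.rot (G.rot (G.side d i))) = G.rot (G.side d i) := by
  have := List.formPerm_apply_getElem _ h.nodup_legs
  fin_cases i
  exacts [this 0 (by simp [legs]), this 2 (by simp [legs]), this 4 (by simp [legs])]

theorem IsTriangle.shift_rot_side (h : G.IsTriangle d) (i : Fin 3) :
    G.shift d (G.rot (G.side d i)) = G.rot (G.rot (G.side d (i + 1))) := by
  have := List.formPerm_apply_getElem _ h.nodup_legs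
  fin_cases i
  exacts [this 1 (by simp [legs]), this 3 (by simp [legs]),
    List.formPerm_apply_getLast _ [_, _, _, _, _]]

theorem shift_eq_self {x : D} (hu : ∀ i, x ≠ G.rot (G.side d i))
    (hw : ∀ i, x ≠ G.rot (G.rot (G.side d i))) : G.shift d x = x := by
  refine List.formPerm_apply_of_notMem fun hx => ?_
  change x ∈ [G.rot (G.rot (G.side d 0)), G.rot (G.side d 0), G.rot (G.rot (G.side d 1)),
    G.rot (G.side d 1), G.rot (G.rot (G.side d 2)), G.rot (G.side d 2)] at hx
  simp [hu, hw] at hx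

theorem IsTriangle.shift_side (h : G.IsTriangle d) (i : Fin 3) :
    G.shift d (G.side d i) = G.side d i :=
  shift_eq_self (fun j => (h.isTriangularFace.rot_side_ne_side j i).symm)
    fun j => (h.isTriangularFace.rot_rot_side_ne_side j i).symm

theorem IsTriangle.shift_rev_side (h : G.IsTriangle d) (i : Fin 3) :
    G.shift d (G.rev (G.side d i)) = G.rev (G.side d i) :=
  shift_eq_self (fun j => (h.isTriangularFace.rot_side_ne_rev_side j i).symm)
    fun j => (h.isTriangularFace.rot_rot_side_ne_rev_side j i).symm

theorem shift_of_isAwayFrom {x : D} (hx : G.IsAwayFrom d x) : G.shift d x = x :=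
  shift_eq_self hx.ne_rot_side hx.ne_rot_rot_side

/-- The map obtained by a triangle move at the triangle to the left of `d`. -/
def movedMap (G : PlaneFourValentGraph D) (d : D) : FourValentMap D where
  rot := G.shift d * G.rot * (G.shift d)⁻¹
  rev := G.rev
  rev_rev := G.rev_rev
  rev_ne := G.rev_ne
  rot_four x := by simp [G.rot_four]
  rot_two_ne x hx := G.rot_two_ne ((G.shift d)⁻¹ x) (by simpa using congrArg (⇑(G.shift d)⁻¹) hx)

theorem movedMap_rot_shift (x : D) :
    (movedMap G d).rot (G.shift d x) = G.shift d (G.rot x) := by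
  simp [movedMap]

theorem IsTriangle.isMove (h : G.IsTriangle d) : G.toFourValentMap.IsMove (movedMap G d) d where
  toIsTriangularFace := h.isTriangularFace
  rev_eq := rfl
  exists_rot_eq_conj := ⟨_, rfl⟩
  rot_side i := by
    rw [← h.shift_side i, movedMap_rot_shift, h.shift_rot_side]
  rot_rot_rot_side i := by
    rw [← h.shift_rot_side i, movedMap_rot_shift, h.shift_rot_rot_side]
  rot_rot_side i := by
    rw [← h.shift_rot_rot_side (i + 1), movedMap_rot_shift, h.isTriangularFace.rot_three_side,
      h.shift_rev_side]
  rot_rev_side i := by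
    rw [← h.shift_rev_side i, movedMap_rot_shift, ← G.next_apply, h.isTriangularFace.next_side,
      h.shift_side]
  rot_eq x hx := by
    nth_rw 1 [← shift_of_isAwayFrom hx]
    rw [movedMap_rot_shift, shift_of_isAwayFrom hx.rot]

end Shift

theorem isSide_rev_side (i : Fin 3) : G.IsSide d (G.rev (G.side d i)) := by
  unfold IsSide
  fin_cases i <;> simp [side]

theorem IsTriangle.exists_triangleMoveAt [DecidableEq D] [Finite D] (h : G.IsTriangle d) {o : D}
    (ho : G.faceOf o = G.outer) (hor : ∀ i, o ≠ G.rev (G.side d i)) :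
    ∃ H : PlaneFourValentGraph D, G.TriangleMoveAt H d ∧
      G.toFourValentMap.IsMove H.toFourValentMap d ∧ H.faceOf o = H.outer := by
  have hmove := h.isMove
  refine ⟨⟨movedMap G d, hmove.connected G.connected, hmove.spherical G.spherical,
    (movedMap G d).faceOf o⟩, ⟨h, rfl, rfl, fun e he => ?_⟩, hmove, rfl⟩
  rw [← ho]
  exact hmove.faceOf_eq_iff (fun i hi => he (hi ▸ isSide_rev_side i)) hor

/-- A minimal lens of `G` that does not contain the unbounded face, in a graph without loop
configurations. The face to the left of `o` is the unbounded one. -/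
structure IsReducibleLens (G : PlaneFourValentGraph D) (o : D) (S : Set D) : Prop where
  not_isLoop : ∀ d, ¬ G.IsLoop d
  faceOf_eq : G.faceOf o = G.outer
  isMinimalLens : G.IsMinimalLens o S

namespace IsReducibleLens

variable {o : D} {S : Set D} (h : G.IsReducibleLens o S)

include h

theorem faceOf_ne (hd : d ∈ S) : G.faceOf d ≠ G.outer := fun hout =>
  h.isMinimalLens.notMem
    ((h.isMinimalLens.region.mem_iff_of_faceOf_eq (hout.trans h.faceOf_eq.symm)).1 hd)

theorem exists_isTriangle [Finite D] (hbigon : ∀ d, ¬ G.IsBigon d) :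
    ∃ d ∈ S, G.rev d ∉ S ∧ G.IsTriangle d := by
  obtain ⟨d, hd, hrev, htri⟩ := h.isMinimalLens.exists_triangle G.connected G.spherical
    (fun d hd hnext => h.not_isLoop d ⟨hnext, h.faceOf_ne hd⟩)
    (fun d hd hnext => by_contra fun hv => hbigon d ⟨hnext, hv, h.faceOf_ne hd⟩)
  exact ⟨d, hd, hrev, htri.1, htri.2, htri.3, htri.4, h.faceOf_ne hd⟩

theorem exists_outer_ne_rev_side (htri : G.IsTriangularFace d) :
    ∃ o', G.faceOf o' = G.outer ∧ o' ∉ S ∧ ∀ i, o' ≠ G.rev (G.side d i) := by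
  by_cases ho : ∃ i, o = G.rev (G.side d i)
  · obtain ⟨i, rfl⟩ := ho
    have hout : G.faceOf (G.rot (G.side d i)) = G.outer := (faceOf_rot_side i).trans h.faceOf_eq
    exact ⟨_, hout, fun hS => h.faceOf_ne hS hout, htri.rot_side_ne_rev_side i⟩
  · push Not at ho
    exact ⟨o, h.faceOf_eq, h.isMinimalLens.notMem, ho⟩

theorem exists_triangleMove [DecidableEq D] [Finite D] (hbigon : ∀ d, ¬ G.IsBigon d) :
    ∃ (H : PlaneFourValentGraph D) (o' : D) (S' : Set D), G.TriangleMove H ∧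
      H.IsReducibleLens o' S' ∧ S'.ncard < S.ncard := by
  obtain ⟨d, hd, hrev, htri⟩ := h.exists_isTriangle hbigon
  obtain ⟨o', ho', ho'S, hne⟩ := h.exists_outer_ne_rev_side htri.isTriangularFace
  obtain ⟨H, hH, hmove, hHo⟩ := htri.exists_triangleMoveAt ho' hne
  have hS := h.isMinimalLens
  obtain ⟨S', hS', hle⟩ := exists_isMinimalLens (hmove.isRegion_shrink hS.region)
    (hmove.isConvex_shrink hS.region hS.convex hd hrev)
    (hmove.nonempty_shrink hS.region hd hS.ncard_corners_le)
    (fun hm => ho'S (hmove.shrink_subset hS.region hS.convex hd hm))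
    ((hmove.ncard_corners_shrink_le hS.region hS.convex hd).trans hS.ncard_corners_le)
  have hlt := Set.ncard_lt_ncard
    (hmove.fill_shrink_ssubset hS.region hS.convex hd hS.coconnected hrev ho'S hne)
  refine ⟨H, o', S', ⟨d, hH⟩, ⟨fun e ⟨he, heo⟩ => ?_, hHo, hS'⟩, hle.trans_lt hlt⟩
  obtain ⟨her, hcase⟩ := hmove.next_eq_or_next_next_eq he
  rw [← hHo, ne_eq, hmove.faceOf_eq_iff her hne, ho'] at heo
  obtain hloop | ⟨hnext, hv⟩ := hcase
  exacts [h.not_isLoop e ⟨hloop, heo⟩, hbigon e ⟨hnext, hv, heo⟩]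

end IsReducibleLens

theorem IsReducibleLens.exists_isBigon [DecidableEq D] [Finite D] {G : PlaneFourValentGraph D}
    {o : D} {S : Set D} (h : G.IsReducibleLens o S) :
    ∃ H : PlaneFourValentGraph D, Relation.ReflTransGen TriangleMove G H ∧ ∃ d, H.IsBigon d := by
  induction hn : S.ncard using Nat.strong_induction_on generalizing G o S with
  | _ n ih =>
    by_cases hbigon : ∃ d, G.IsBigon d
    · exact ⟨G, .refl, hbigon⟩
    obtain ⟨H, o', S', hGH, h', hlt⟩ := h.exists_triangleMove (not_exists.1 hbigon)
    obtain ⟨K, hHK, hK⟩ := ih _ (hn ▸ hlt) h' rfl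
    exact ⟨K, .head hGH hHK, hK⟩

end PlaneFourValentGraph

theorem lemma2 {D : Type*} [Fintype D] [DecidableEq D] (G : PlaneFourValentGraph D)
    (hvertex : Nonempty G.Vertex)
    (hloop : ¬ ∃ d, G.IsLoop d) (hbigon : ¬ ∃ d, G.IsBigon d) :
    ∃ H : PlaneFourValentGraph D,
      Relation.ReflTransGen PlaneFourValentGraph.TriangleMove G H ∧ ∃ d, H.IsBigon d := by
  obtain ⟨o, ho⟩ := G.faceOf_surjective G.outer
  obtain ⟨X, hX, hconv, hne, hcard, hoX, -⟩ :=
    FourValentMap.exists_convex_of_strand G.connected G.spherical o o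
  obtain ⟨S, hS, -⟩ := FourValentMap.exists_isMinimalLens hX hconv hne hoX (hcard.trans one_le_two)
  exact PlaneFourValentGraph.IsReducibleLens.exists_isBigon ⟨not_exists.1 hloop, ho, hS⟩
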